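/- Let $\Omega\subset\mathbb C^n$ be a bounded domain with Bergman kernel $K(z,\zeta)=\sum_i\varphi_i(z)\overline{\varphi_i(\zeta)}$, where $(\varphi_i)$ is an orthonormal basis of the space of square-integrable holomorphic functions on $\Omega$. Let $T_{i\bar j}(z)=\frac{\partial^2}{\partial z_i\partial\bar z_j}\log K(z,z)$ be the Bergman metric, $Ric_{i\bar j}=-\frac{\partial^2}{\partial z_i\partial\bar z_j}\log\det(T_{k\bar l})$ its Ricci tensor, and let $\widetilde{dist}_\Omega$ be the distance of the Kähler metric $(n+1)T_{i\bar j}-Ric_{i\bar j}$, i.e. the infimum of the lengths $\int_0^1\big(\sum_{i,j}((n+1)T_{i\bar j}-Ric_{i\bar j})(\gamma(t))\,\gamma_i'(t)\overline{\gamma_j'(t)}\big)^{1/2}dt$ over all piecewise $C^1$ curves $\gamma:[0,1]\to\Omega$ joining the two points. For $z_0\in\Omega$ the Bergman representative coordinates are $$w_i(z)=\sum_{j=1}^n T^{\bar j i}(z_0)\,\frac{\partial}{\partial\bar\zeta_j}\log\frac{K(z,\zeta)}{K(\zeta,\zeta)}\Big|_{\zeta=z_0},\qquad i=1,\dots,n,$$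 where $(T^{\bar j i}(z_0))$ is the inverse matrix of $(T_{i\bar j}(z_0))$; they are defined and holomorphic at the points $z\in\Omega$ with $K(z,z_0)\neq0$. **Theorem.** For every $\varepsilon>0$ there exist a bounded domain $\Omega_\varepsilon$ and a point $z_0\in\Omega_\varepsilon$ such that $z\mapsto(w_1(z),\dots,w_n(z))$ fails to be an immersion in the whole geodesic ball $\{z\in\Omega_\varepsilon:\widetilde{dist}_{\Omega_\varepsilon}(z,z_0)<\frac{\pi}{2}+\varepsilon\}$. More precisely, $\Omega_\varepsilon$ can be taken to be a circular annulus $\{z\in\mathbb C: r<|z|<1\}$ with some $0<r<1$ (so $n=1$), and the ball contains a point $z$ with $K(z,z_0)\neq0$ at which the differential of this map is not injective. -/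

import Mathlib

open scoped ComplexConjugate ENNReal

noncomputable section

namespace Bergman

/-- A bounded domain of complex `n`-space: open, connected (in particular nonempty), bounded. -/
structure IsBoundedDomain {n : ℕ} (Ω : Set (Fin n → ℂ)) : Prop where
  isOpen : IsOpen Ω
  isConnected : IsConnected Ω
  isBounded : Bornology.IsBounded Ω

/-- Membership in the space of square-integrable holomorphic functions on `Ω`
(Lebesgue measure). Values off `Ω` are irrelevant. -/
def MemBergmanSpace {n : ℕ} (Ω : Set (Fin n → ℂ)) (f : (Fin n → ℂ) → ℂ) : Prop :=
  DifferentiableOn ℂ f Ω ∧ MeasureTheory.MemLp f 2 (MeasureTheory.volume.restrict Ω)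

/-- The scalar product of square-integrable functions on `Ω`. -/
def l2Inner {n : ℕ} (Ω : Set (Fin n → ℂ)) (f g : (Fin n → ℂ) → ℂ) : ℂ :=
  ∫ z in Ω, f z * conj (g z)

/-- A complete orthonormal system of the Hilbert space of square-integrable holomorphic functions
on `Ω`. (This space is infinite-dimensional and separable for every bounded domain with `1 ≤ n`,
so the index set is `ℕ`.) -/
structure IsOrthonormalBasis {n : ℕ} (Ω : Set (Fin n → ℂ)) (φ : ℕ → (Fin n → ℂ) → ℂ) : Prop where
  mem : ∀ i, MemBergmanSpace Ω (φ i)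
  orthonormal : ∀ i j, l2Inner Ω (φ i) (φ j) = if i = j then 1 else 0
  complete : ∀ f, MemBergmanSpace Ω f → (∀ i, l2Inner Ω f (φ i) = 0) → ∀ z ∈ Ω, f z = 0

open Classical in
/-- The Bergman kernel `K(z,w) = ∑ φᵢ(z) * conj (φᵢ(w))`, for an orthonormal basis `φ` of the space
of square-integrable holomorphic functions; on `Ω × Ω` the sum does not depend on the basis. -/
def kernel {n : ℕ} (Ω : Set (Fin n → ℂ)) (z w : Fin n → ℂ) : ℂ :=
  if h : ∃ φ : ℕ → (Fin n → ℂ) → ℂ, IsOrthonormalBasis Ω φ then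
    ∑' i, h.choose i z * conj (h.choose i w)
  else 0

/-- The Wirtinger derivative `∂/∂zᵢ`. -/
def dz {n : ℕ} (i : Fin n) (f : (Fin n → ℂ) → ℂ) (z : Fin n → ℂ) : ℂ :=
  (1 / 2) * (fderiv ℝ f z (Pi.single i 1) - Complex.I * fderiv ℝ f z (Pi.single i Complex.I))

/-- The Wirtinger derivative `∂/∂z̄ᵢ`. -/
def dzbar {n : ℕ} (i : Fin n) (f : (Fin n → ℂ) → ℂ) (z : Fin n → ℂ) : ℂ :=
  (1 / 2) * (fderiv ℝ f z (Pi.single i 1) + Complex.I * fderiv ℝ f z (Pi.single i Complex.I))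

/-- The matrix of the Bergman metric, `T i j = ∂²/∂zᵢ∂z̄ⱼ log K(z,z)`. -/
def metricT {n : ℕ} (Ω : Set (Fin n → ℂ)) (z : Fin n → ℂ) : Matrix (Fin n) (Fin n) ℂ :=
  Matrix.of fun i j => dz i (dzbar j fun ζ => Complex.log (kernel Ω ζ ζ)) z

/-- The Ricci tensor of the Bergman metric, `Ric i j = -∂²/∂zᵢ∂z̄ⱼ log det T`. -/
def ricci {n : ℕ} (Ω : Set (Fin n → ℂ)) (z : Fin n → ℂ) : Matrix (Fin n) (Fin n) ℂ :=
  Matrix.of fun i j => -dz i (dzbar j fun ζ => Complex.log (metricT Ω ζ).det) z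

/-- The matrix of the modified metric `(n+1) T - Ric`. -/
def modifiedMetric {n : ℕ} (Ω : Set (Fin n → ℂ)) (z : Fin n → ℂ) : Matrix (Fin n) (Fin n) ℂ :=
  ((n : ℂ) + 1) • metricT Ω z - ricci Ω z

/-- The length of the vector `X` at the point `z` in the modified metric: the square root of
`∑ i j, ((n+1) T - Ric) i j * X i * conj (X j)`. -/
def modifiedNorm {n : ℕ} (Ω : Set (Fin n → ℂ)) (z X : Fin n → ℂ) : ℝ :=
  Real.sqrt (∑ i, ∑ j, modifiedMetric Ω z i j * X i * conj (X j)).re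

/-- Piecewise `C¹` curves `[0,1] → ℂⁿ`: there is a partition of `[0,1]` such that the curve is `C¹`
on each closed piece (hence continuous on `[0,1]`). -/
def IsPiecewiseC1 {n : ℕ} (γ : ℝ → Fin n → ℂ) : Prop :=
  ∃ (m : ℕ) (t : Fin (m + 1) → ℝ), StrictMono t ∧ t 0 = 0 ∧ t (Fin.last m) = 1 ∧
    ∀ k : Fin m, ContDiffOn ℝ 1 γ (Set.Icc (t k.castSucc) (t k.succ))

/-- The length of a piecewise `C¹` curve in the modified metric. The derivative exists at all but
finitely many points of `[0,1]`. -/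
def modifiedLength {n : ℕ} (Ω : Set (Fin n → ℂ)) (γ : ℝ → Fin n → ℂ) : ℝ≥0∞ :=
  ∫⁻ t in Set.Icc (0 : ℝ) 1, ENNReal.ofReal (modifiedNorm Ω (γ t) (deriv γ t))

/-- The distance of the modified metric: the infimum of the lengths of the piecewise `C¹` curves in
`Ω` that join the two points. -/
def modifiedDist {n : ℕ} (Ω : Set (Fin n → ℂ)) (z w : Fin n → ℂ) : ℝ≥0∞ :=
  ⨅ (γ : ℝ → Fin n → ℂ) (_ : IsPiecewiseC1 γ ∧ (∀ t ∈ Set.Icc (0 : ℝ) 1, γ t ∈ Ω) ∧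
    γ 0 = z ∧ γ 1 = w), modifiedLength Ω γ

/-- The open geodesic ball of radius `ρ` about `z₀` in the modified metric. -/
def modifiedBall {n : ℕ} (Ω : Set (Fin n → ℂ)) (z₀ : Fin n → ℂ) (ρ : ℝ) : Set (Fin n → ℂ) :=
  {z | z ∈ Ω ∧ modifiedDist Ω z z₀ < ENNReal.ofReal ρ}

/-- The Bergman representative coordinates with respect to `z₀`,
`wᵢ(z) = ∑ⱼ (T(z₀)⁻¹) j i * ∂/∂ζ̄ⱼ log (K(z,ζ)/K(ζ,ζ))` at `ζ = z₀`. The derivative of the logarithm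
is the logarithmic derivative, so no branch is chosen; the formula is meaningful at the points `z`
of `Ω` where `K(z,z₀) ≠ 0`. -/
def representativeMap {n : ℕ} (Ω : Set (Fin n → ℂ)) (z₀ z : Fin n → ℂ) : Fin n → ℂ := fun i =>
  ∑ j, (metricT Ω z₀)⁻¹ j i *
    (dzbar j (fun ζ => kernel Ω z ζ / kernel Ω ζ ζ) z₀ / (kernel Ω z z₀ / kernel Ω z₀ z₀))

/-- The circular annulus `{r < |z| < 1}` in complex dimension one. -/
def annulus (r : ℝ) : Set (Fin 1 → ℂ) :=
  {z | r < ‖z 0‖ ∧ ‖z 0‖ < 1}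

end Bergman

end

/-!
On the annulus `A = {r < |z| < 1}` the monomials are a complete orthogonal system of the Bergman
space, so the kernel is a function `k(z w̄)` given by a Laurent series. Put `t = z w̄` and
`F_j = (t d/dt)^j (t k)`. With the discriminant `D = F₀ F₂ - F₁²`,

* the representative coordinate of `z` with respect to `z₀` is an affine function of the
  logarithmic derivative `F₁ / F₀ - 1` at `t = z z̄₀` (`representativeMap_annulus`), whose derivative
  `D / (t F₀²)` vanishes exactly at the zeros of `D` (`hasDerivAt_kernelLogDeriv`);
* at the points of the circle `|z|² = r` the modified metric `2 T - Ric` is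
  `(F₄ / F₂ - F₂ / F₀)(r) / r` (`modifiedMetric_annulus`), since on `A` the reflection `t ↦ r² / t`
  is a symmetry of the series, which kills the odd `F_j` at `t = r`.

For `r → 0` the series on `|t| = r`, that is `t = r exp(iθ)`, are dominated by their terms of
index `-1, 0, 1`: `F₀ ≈ β₀ + 2 β₁ cos θ` and `F₂ ≈ F₄ ≈ 2 β₁ cos θ` with `β₁ ≈ r / π` and
`β₀ = 1 / (2 π log (1 / r))`. Hence `D ≈ 2 β₀ β₁ cos θ`, and `A` behaves near `|z|² = r` like a domain
in the Riemann sphere with its Fubini–Study metric, where points at distance `π / 2` represent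
orthogonal lines. Precisely, `D` is real on `|t| = r`, positive at `θ = 0` and negative at
`θ = π / 2 + δ`, so that it has a zero in between (`exists_eulerDiscr_eq_zero`); the points `z₀ = √r`
and `z = √r exp(iθ)` are joined by an arc of the circle `|z|² = r` of length
`θ √(F₄ / F₂ - F₂ / F₀)(r)`, where `F₄ / F₂ → 1` (`modifiedDist_le`).

The kernel is defined through an unspecified orthonormal basis. That it does not depend on the basis
(`exists_hasSum_mul_conj`) is Parseval's identity in the Bergman space, whose completeness follows
from the area mean value property (`isClosed_bergmanSubmodule`).
-/

noncomputable section

open MeasureTheory Set Filter Topology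

namespace Bergman

/-! ### Integration in polar coordinates and the area mean value property -/

theorem integrableOn_polarCoord_symm {g : ℂ → ℂ} (hg : Integrable g) :
    IntegrableOn (fun p : ℝ × ℝ => p.1 • g (Complex.polarCoord.symm p)) polarCoord.target := by
  have h1 : Integrable (g ∘ Complex.measurableEquivRealProd.symm) :=
    (Complex.volume_preserving_equiv_real_prod.symm.integrable_comp_emb
      Complex.measurableEquivRealProd.symm.measurableEmbedding).2 hg
  have h2 := (integrableOn_image_iff_integrableOn_abs_det_fderiv_smul volume
    polarCoord.open_target.measurableSet
    (fun p _ => (hasFDerivAt_polarCoord_symm p).hasFDerivWithinAt) polarCoord.symm.injOn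
    (g ∘ Complex.measurableEquivRealProd.symm)).1 h1.integrableOn
  refine h2.congr_fun (fun p hp => ?_) polarCoord.open_target.measurableSet
  simp only [det_fderivPolarCoordSymm, abs_of_pos (show 0 < p.1 from hp.1)]
  rfl

/-- The open shell `a < |z| < b` in the complex plane. -/
def shell (a b : ℝ) : Set ℂ := {z | a < ‖z‖ ∧ ‖z‖ < b}

theorem isOpen_shell (a b : ℝ) : IsOpen (shell a b) :=
  (isOpen_lt continuous_const continuous_norm).inter (isOpen_lt continuous_norm continuous_const)

/-- Integration over a shell as a weighted integral of circle averages. -/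
theorem integral_shell {a b : ℝ} (ha : 0 ≤ a) {g : ℂ → ℂ} (hg : IntegrableOn g (shell a b)) :
    ∫ z in shell a b, g z =
      ∫ ρ in Ioo a b, (2 * Real.pi * ρ) • Real.circleAverage g 0 ρ := by
  have hS : MeasurableSet (shell a b) := (isOpen_shell a b).measurableSet
  have hi := integrableOn_polarCoord_symm ((integrable_indicator_iff hS).2 hg)
  rw [← integral_indicator hS, ← Complex.integral_comp_polarCoord_symm]
  change IntegrableOn _ (Ioi (0 : ℝ) ×ˢ Ioo (-Real.pi) Real.pi) (volume.prod volume) at hi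
  change ∫ p in Ioi (0 : ℝ) ×ˢ Ioo (-Real.pi) Real.pi, _ ∂(volume.prod volume) = _
  rw [setIntegral_prod _ hi]
  have key : ∀ ρ ∈ Ioi (0 : ℝ), ∫ θ in Ioo (-Real.pi) Real.pi,
      ρ • (shell a b).indicator g (Complex.polarCoord.symm (ρ, θ)) =
      (Ioo a b).indicator (fun ρ => (2 * Real.pi * ρ) • Real.circleAverage g 0 ρ) ρ := by
    intro ρ hρ
    have hn : ∀ θ : ℝ, ‖Complex.polarCoord.symm (ρ, θ)‖ = ρ := fun θ => by
      rw [Complex.norm_polarCoord_symm, abs_of_pos hρ]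
    have hmem : ∀ θ : ℝ, Complex.polarCoord.symm (ρ, θ) ∈ shell a b ↔ ρ ∈ Ioo a b := fun θ => by
      change _ < ‖_‖ ∧ ‖_‖ < _ ↔ _
      rw [hn]
      rfl
    by_cases h : ρ ∈ Ioo a b
    · rw [indicator_of_mem h, integral_smul]
      have h1 : ∀ θ : ℝ, (shell a b).indicator g (Complex.polarCoord.symm (ρ, θ)) =
          g (circleMap 0 ρ θ) := fun θ => by
        rw [indicator_of_mem ((hmem θ).2 h)]
        simp [circleMap, Complex.exp_mul_I]
      simp_rw [h1]
      rw [Real.circleAverage_eq_integral_add (-Real.pi),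
        intervalIntegral.integral_comp_add_right (fun θ => g (circleMap 0 ρ θ)),
        ← integral_Ioc_eq_integral_Ioo, ← intervalIntegral.integral_of_le (by linarith [Real.pi_pos]),
        smul_smul]
      congr 1
      · field_simp
      · congr 1 <;> ring
    · rw [indicator_of_notMem h]
      have h1 : ∀ θ : ℝ, (shell a b).indicator g (Complex.polarCoord.symm (ρ, θ)) = 0 :=
        fun θ => indicator_of_notMem (fun h' => h ((hmem θ).1 h')) _
      simp_rw [h1, smul_zero, integral_zero]
  rw [setIntegral_congr_fun measurableSet_Ioi key, setIntegral_indicator measurableSet_Ioo,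
    inter_eq_right.2 (show Ioo a b ⊆ Ioi 0 from fun x hx => lt_of_le_of_lt ha hx.1)]

/-- The area mean value property of holomorphic functions. -/
theorem integral_ball {f : ℂ → ℂ} {c : ℂ} {δ : ℝ} (hδ : 0 < δ)
    (hf : DifferentiableOn ℂ f (Metric.closedBall c δ)) :
    ∫ z in Metric.ball c δ, f z = (Real.pi * δ ^ 2) • f c := by
  have h1 : ∫ z in Metric.ball c δ, f z = ∫ z in Metric.ball (0 : ℂ) δ, f (z + c) := by
    rw [← integral_indicator measurableSet_ball, ← integral_indicator measurableSet_ball,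
      ← integral_add_right_eq_self _ c]
    congr 1
    ext z
    simp [indicator, Metric.mem_ball, dist_eq_norm]
  have h2 : Metric.ball (0 : ℂ) δ =ᵐ[volume] shell 0 δ := by
    have : shell 0 δ = Metric.ball (0 : ℂ) δ \ {0} := by
      ext z; simp [shell, and_comm]
    rw [this]
    exact (sdiff_null_ae_eq_self (by simp)).symm
  have hc : ContinuousOn (fun z => f (z + c)) (Metric.closedBall 0 δ) := by
    refine hf.continuousOn.comp (by fun_prop) fun z hz => ?_
    simpa [Metric.mem_closedBall, dist_eq_norm] using hz
  have hi : IntegrableOn (fun z => f (z + c)) (shell 0 δ) :=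
    (hc.integrableOn_compact (isCompact_closedBall _ _)).mono_set fun z hz => by
      simpa using hz.2.le
  rw [h1, setIntegral_congr_set h2, integral_shell le_rfl hi]
  have h3 : ∀ ρ ∈ Ioo (0 : ℝ) δ, (2 * Real.pi * ρ) •
      Real.circleAverage (fun z => f (z + c)) 0 ρ = (2 * Real.pi * ρ) • f c := by
    intro ρ hρ
    rw [Real.circleAverage_map_add_const, DiffContOnCl.circleAverage]
    apply DifferentiableOn.diffContOnCl
    apply hf.mono
    rw [abs_of_pos hρ.1]
    exact Metric.closure_ball_subset_closedBall.trans (Metric.closedBall_subset_closedBall hρ.2.le)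
  rw [setIntegral_congr_fun measurableSet_Ioo h3, integral_smul_const,
    ← integral_Ioc_eq_integral_Ioo, ← intervalIntegral.integral_of_le hδ.le,
    intervalIntegral.integral_const_mul, integral_id]
  congr 1
  ring

/-! ### Completeness of the Bergman space and independence of the kernel from the basis -/

/-- The classes in `L²(U)` that have a holomorphic representative. -/
def bergmanSubmodule (U : Set ℂ) : Submodule ℂ (Lp ℂ 2 (volume.restrict U)) where
  carrier := {x | ∃ f : ℂ → ℂ, DifferentiableOn ℂ f U ∧ x =ᵐ[volume.restrict U] f}
  add_mem' := by
    rintro x y ⟨f, hf, hx⟩ ⟨g, hg, hy⟩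
    exact ⟨f + g, hf.add hg, (Lp.coeFn_add x y).trans (hx.add hy)⟩
  zero_mem' := ⟨0, differentiableOn_const 0, Lp.coeFn_zero _ _ _⟩
  smul_mem' := by
    rintro c x ⟨f, hf, hx⟩
    exact ⟨c • f, hf.const_smul c, (Lp.coeFn_smul c x).trans (hx.const_smul c)⟩

/-- The normalized indicator of a disc: its scalar product with a holomorphic function is the
value at the center. -/
def meanValueVector (U : Set ℂ) (c : ℂ) (δ : ℝ) : Lp ℂ 2 (volume.restrict U) :=
  ((Real.pi * δ ^ 2)⁻¹ : ℂ) • indicatorConstLp 2 (Metric.isOpen_ball (x := c) (ε := δ)).measurableSet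
    ((Measure.restrict_apply_le U _).trans_lt measure_ball_lt_top).ne (1 : ℂ)

theorem inner_meanValueVector {U : Set ℂ} {c : ℂ} {δ : ℝ} (hδ : 0 < δ)
    (hU : Metric.closedBall c δ ⊆ U) {f : ℂ → ℂ} (hf : DifferentiableOn ℂ f U)
    {x : Lp ℂ 2 (volume.restrict U)} (hx : x =ᵐ[volume.restrict U] f) :
    inner ℂ (meanValueVector U c δ) x = f c := by
  rw [meanValueVector, inner_smul_left, L2.inner_indicatorConstLp_one,
    setIntegral_congr_ae Metric.isOpen_ball.measurableSet (hx.mono fun z hz _ => hz),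
    Measure.restrict_restrict Metric.isOpen_ball.measurableSet,
    inter_eq_left.2 (Metric.ball_subset_closedBall.trans hU), integral_ball hδ (hf.mono hU)]
  have : (Real.pi : ℂ) ≠ 0 := by exact_mod_cast Real.pi_ne_zero
  have : (δ : ℂ) ≠ 0 := by exact_mod_cast hδ.ne'
  simp [Complex.real_smul]
  field_simp

theorem norm_meanValueVector_le (U : Set ℂ) (c : ℂ) (δ : ℝ) :
    ‖meanValueVector U c δ‖ ≤
      ‖((Real.pi * δ ^ 2)⁻¹ : ℂ)‖ * (volume.real (Metric.ball (0 : ℂ) δ)) ^ (1 / 2 : ℝ) := by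
  have : volume.real (Metric.ball (0 : ℂ) δ) = volume.real (Metric.ball c δ) := by
    simp [Measure.real, Complex.volume_ball]
  rw [meanValueVector, norm_smul, norm_indicatorConstLp (by simp) (by simp), this, norm_one, one_mul]
  gcongr
  · simp only [ENNReal.toReal_ofNat]
    gcongr
    exact ENNReal.toReal_mono measure_ball_lt_top.ne (Measure.restrict_apply_le U _)

/-- The Bergman space is complete: by the mean value property, convergence in `L²` forces locally
uniform convergence. -/
theorem isClosed_bergmanSubmodule {U : Set ℂ} (hU : IsOpen U) :
    IsClosed (bergmanSubmodule U : Set (Lp ℂ 2 (volume.restrict U))) := by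
  apply IsSeqClosed.isClosed
  intro x l hx hl
  choose f hf hxf using hx
  have loc : ∀ w ∈ U, ∃ δ > 0, ∃ C : ℝ, ∀ u ∈ Metric.ball w δ, u ∈ U ∧ ∀ m n,
      dist (f m u) (f n u) ≤ C * dist (x m) (x n) := by
    intro w hw
    obtain ⟨δ, hδ, hsub⟩ := Metric.isOpen_iff.1 hU w hw
    refine ⟨δ / 2, by positivity, ‖((Real.pi * (δ / 3 : ℝ) ^ 2)⁻¹ : ℂ)‖ *
      (volume.real (Metric.ball (0 : ℂ) (δ / 3))) ^ (1 / 2 : ℝ), fun u hu => ⟨?_, fun m n => ?_⟩⟩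
    · exact hsub (Metric.ball_subset_ball (by linarith) hu)
    · -- `δ / 2 + δ / 3 < δ`: discs of one fixed radius fit around all points near `w`.
      have hsub' : Metric.closedBall u (δ / 3) ⊆ U := fun v hv => hsub (by
        rw [Metric.mem_ball] at hu ⊢
        rw [Metric.mem_closedBall] at hv
        linarith [dist_triangle v u w])
      have h3 : 0 < δ / 3 := by positivity
      rw [dist_eq_norm, dist_eq_norm, ← inner_meanValueVector h3 hsub' (hf m) (hxf m),
        ← inner_meanValueVector h3 hsub' (hf n) (hxf n), ← inner_sub_right]
      exact (norm_inner_le_norm _ _).trans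
        (mul_le_mul_of_nonneg_right (norm_meanValueVector_le U u _) (norm_nonneg _))
  have hcau := hl.cauchySeq
  have hunif : ∀ w ∈ U, ∃ δ > 0, UniformCauchySeqOn f atTop (Metric.ball w δ) := by
    intro w hw
    obtain ⟨δ, hδ, C, hC⟩ := loc w hw
    refine ⟨δ, hδ, Metric.uniformCauchySeqOn_iff.2 fun ε hε => ?_⟩
    obtain ⟨N, hN⟩ := Metric.cauchySeq_iff.1 hcau (ε / (|C| + 1)) (by positivity)
    refine ⟨N, fun m hm n hn u hu => ((hC u hu).2 m n).trans_lt ?_⟩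
    have := hN m hm n hn
    rw [lt_div_iff₀ (by positivity)] at this
    nlinarith [le_abs_self C, dist_nonneg (x := x m) (y := x n)]
  have hlim : ∀ w, ∃ L, w ∈ U → Tendsto (fun n => f n w) atTop (𝓝 L) := by
    intro w
    by_cases hw : w ∈ U
    · obtain ⟨δ, hδ, h⟩ := hunif w hw
      obtain ⟨L, hL⟩ := cauchySeq_tendsto_of_complete (h.cauchySeq (Metric.mem_ball_self hδ))
      exact ⟨L, fun _ => hL⟩
    · exact ⟨0, fun h => absurd h hw⟩
  choose F hF using hlim
  have hloc : TendstoLocallyUniformlyOn f F atTop U := by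
    intro v hv w hw
    obtain ⟨δ, hδ, h⟩ := hunif w hw
    exact ⟨Metric.ball w δ ∩ U, inter_mem (mem_nhdsWithin_of_mem_nhds (Metric.ball_mem_nhds w hδ))
      self_mem_nhdsWithin, (h.mono inter_subset_left).tendstoUniformlyOn_of_tendsto
        (fun u hu => hF u hu.2) v hv⟩
  refine ⟨F, hloc.differentiableOn (Eventually.of_forall hf) hU, ?_⟩
  obtain ⟨ns, hns, hae⟩ := (tendstoInMeasure_of_tendsto_Lp hl).exists_seq_tendsto_ae
  filter_upwards [hae, ae_all_iff.2 hxf, ae_restrict_mem hU.measurableSet] with z h1 h2 h3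
  refine tendsto_nhds_unique h1 ?_
  simp_rw [h2]
  exact (hF z h3).comp hns.tendsto_atTop

/-- A complete orthonormal system of the space of square-integrable holomorphic functions on a
plane open set, with an arbitrary index type. -/
structure IsPlanarOrthonormalBasis (U : Set ℂ) {ι : Type} [DecidableEq ι] (ψ : ι → ℂ → ℂ) :
    Prop where
  differentiableOn : ∀ i, DifferentiableOn ℂ (ψ i) U
  memLp : ∀ i, MemLp (ψ i) 2 (volume.restrict U)
  orthonormal : ∀ i j, ∫ z in U, ψ i z * conj (ψ j z) = if i = j then 1 else 0
  complete : ∀ f, DifferentiableOn ℂ f U → MemLp f 2 (volume.restrict U) →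
    (∀ i, ∫ z in U, f z * conj (ψ i z) = 0) → ∀ z ∈ U, f z = 0

theorem inner_toLp {U : Set ℂ} {f g : ℂ → ℂ} (hf : MemLp f 2 (volume.restrict U))
    (hg : MemLp g 2 (volume.restrict U)) :
    inner ℂ (hf.toLp f) (hg.toLp g) = ∫ z in U, g z * conj (f z) := by
  rw [L2.inner_def]
  apply integral_congr_ae
  filter_upwards [hf.coeFn_toLp, hg.coeFn_toLp] with z h1 h2
  rw [h1, h2, RCLike.inner_apply]

/-- Independence of the Bergman kernel from the orthonormal basis: by Parseval's identity the sum
is the scalar product of the vectors that represent the evaluations at the two points. -/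
theorem exists_hasSum_mul_conj {U : Set ℂ} (hU : IsOpen U) {z w : ℂ} (hz : z ∈ U) (hw : w ∈ U) :
    ∃ s : ℂ, ∀ {ι : Type} [DecidableEq ι] (ψ : ι → ℂ → ℂ), IsPlanarOrthonormalBasis U ψ →
      HasSum (fun i => ψ i z * conj (ψ i w)) s := by
  let V := bergmanSubmodule U
  have : CompleteSpace V := (isClosed_bergmanSubmodule hU).completeSpace_coe
  -- Evaluation at `c` is represented by the projection of the normalized indicator of a disc.
  have rep : ∀ c ∈ U, ∃ k : V, ∀ (y : V) (f : ℂ → ℂ), DifferentiableOn ℂ f U →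
      (y : Lp ℂ 2 (volume.restrict U)) =ᵐ[volume.restrict U] f → inner ℂ k y = f c := by
    intro c hc
    obtain ⟨δ, hδ, hsub⟩ := Metric.nhds_basis_closedBall.mem_iff.1 (hU.mem_nhds hc)
    refine ⟨V.orthogonalProjectionOnto (meanValueVector U c δ), fun y f hf hy => ?_⟩
    rw [← inner_meanValueVector hδ hsub hf hy,
      Submodule.inner_orthogonalProjectionOnto_eq_of_mem_right]
  obtain ⟨kz, hkz⟩ := rep z hz
  obtain ⟨kw, hkw⟩ := rep w hw
  refine ⟨inner ℂ kz kw, fun {ι} _ ψ hψ => ?_⟩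
  let e : ι → V := fun i => ⟨(hψ.memLp i).toLp (ψ i), ψ i, hψ.differentiableOn i,
    (hψ.memLp i).coeFn_toLp⟩
  have he : Orthonormal ℂ e := by
    rw [orthonormal_iff_ite]
    intro i j
    rw [Submodule.coe_inner, inner_toLp, hψ.orthonormal]
    simp [eq_comm]
  have hc : (Submodule.span ℂ (range e))ᗮ = ⊥ := by
    rw [Submodule.eq_bot_iff]
    rintro ⟨y, f, hf, hy⟩ hye
    have hmem : MemLp f 2 (volume.restrict U) := (memLp_congr_ae hy).1 (Lp.memLp y)
    have hyf : y = hmem.toLp f := Lp.ext (hy.trans hmem.coeFn_toLp.symm)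
    have h0 := hψ.complete f hf hmem fun i => by
      have := (Submodule.mem_orthogonal _ _).1 hye (e i) (Submodule.subset_span ⟨i, rfl⟩)
      rwa [Submodule.coe_inner, show ((⟨y, f, hf, hy⟩ : V) : Lp ℂ 2 (volume.restrict U)) =
        hmem.toLp f from hyf, inner_toLp] at this
    apply Subtype.ext
    apply Lp.ext
    refine hy.trans (EventuallyEq.trans ?_ (Lp.coeFn_zero _ _ _).symm)
    filter_upwards [ae_restrict_mem hU.measurableSet] with u hu using h0 u hu
  have hb := (HilbertBasis.mkOfOrthogonalEqBot he hc).hasSum_inner_mul_inner kz kw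
  rw [HilbertBasis.coe_mkOfOrthogonalEqBot] at hb
  have h : (fun i => ψ i z * conj (ψ i w)) = fun i => inner ℂ kz (e i) * inner ℂ (e i) kw := by
    funext i
    have hi : ((e i : V) : Lp ℂ 2 (volume.restrict U)) =ᵐ[volume.restrict U] ψ i :=
      (hψ.memLp i).coeFn_toLp
    rw [hkz _ _ (hψ.differentiableOn i) hi, ← inner_conj_symm (e i) kw,
      hkw _ _ (hψ.differentiableOn i) hi]
  rw [h]
  exact hb

/-! ### The monomial basis on the annulus -/

theorem circleAverage_eq_of_differentiableOn_shell {a b : ℝ} (ha : 0 ≤ a) {h : ℂ → ℂ}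
    (hh : DifferentiableOn ℂ h (shell a b)) {ρ σ : ℝ} (hρ : ρ ∈ Ioo a b) (hσ : σ ∈ Ioo a b) :
    Real.circleAverage h 0 ρ = Real.circleAverage h 0 σ := by
  wlog hle : ρ ≤ σ generalizing ρ σ
  · exact (this hσ hρ (le_of_not_ge hle)).symm
  have hρ0 : 0 < ρ := ha.trans_lt hρ.1
  rw [Real.circleAverage_eq_circleIntegral hρ0.ne',
    Real.circleAverage_eq_circleIntegral (hρ0.trans_le hle).ne',
    Complex.circleIntegral_sub_center_inv_smul_eq_of_differentiable_on_annulus_off_countable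
      hρ0 hle countable_empty]
  · refine hh.continuousOn.mono fun z hz => ?_
    simp only [Set.mem_sdiff, Metric.mem_closedBall, Metric.mem_ball, dist_zero_right, not_lt] at hz
    exact ⟨hρ.1.trans_le hz.2, hz.1.trans_lt hσ.2⟩
  · intro z hz
    simp only [Set.mem_sdiff, Metric.mem_closedBall, Metric.mem_ball, dist_zero_right, not_le] at hz
    exact hh.differentiableAt ((isOpen_shell a b).mem_nhds
      ⟨hρ.1.trans hz.1.2, hz.1.1.trans hσ.2⟩)

/-- The squared norm of `z ^ m` in the Bergman space of the annulus `r < |z| < 1`, divided by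
`2 π`. -/
def radialMoment (r : ℝ) (m : ℤ) : ℝ := ∫ ρ in Ioo r 1, ρ ^ (2 * m + 1)

variable {r : ℝ}

theorem ne_zero_of_mem_shell (hr : 0 < r) {z : ℂ} (hz : z ∈ shell r 1) : z ≠ 0 :=
  norm_pos_iff.1 (hr.trans hz.1)

theorem differentiableOn_zpow_shell (hr : 0 < r) (m : ℤ) :
    DifferentiableOn ℂ (fun z : ℂ => z ^ m) (shell r 1) := fun _ hz =>
  (differentiableAt_zpow.2 (Or.inl (ne_zero_of_mem_shell hr hz))).differentiableWithinAt

theorem volume_shell_lt_top (a b : ℝ) : volume (shell a b) < ⊤ :=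
  (measure_mono (show shell a b ⊆ Metric.ball 0 b from fun z hz => by simpa using hz.2)).trans_lt
    measure_ball_lt_top

theorem memLp_zpow_shell (hr : 0 < r) (m : ℤ) (p : ℝ≥0∞) :
    MemLp (fun z : ℂ => z ^ m) p (volume.restrict (shell r 1)) := by
  have : IsFiniteMeasure (volume.restrict (shell r 1)) := ⟨by
    simpa using volume_shell_lt_top r 1⟩
  have hcpt : IsCompact {z : ℂ | r ≤ ‖z‖ ∧ ‖z‖ ≤ 1} :=
    (isCompact_closedBall (0 : ℂ) 1).of_isClosed_subset
      ((isClosed_le continuous_const continuous_norm).inter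
        (isClosed_le continuous_norm continuous_const)) fun z hz => by simpa using hz.2
  obtain ⟨C, hC⟩ := hcpt.exists_bound_of_continuousOn (f := fun z : ℂ => z ^ m) fun z hz =>
    (continuousAt_zpow₀ z m (Or.inl (norm_pos_iff.1 (hr.trans_le hz.1)))).continuousWithinAt
  refine MemLp.of_bound ((differentiableOn_zpow_shell hr m).continuousOn.aestronglyMeasurable
    (isOpen_shell r 1).measurableSet) C ?_
  filter_upwards [ae_restrict_mem (isOpen_shell r 1).measurableSet] with z hz
  exact hC z ⟨hz.1.le, hz.2.le⟩

/-- The scalar product of a holomorphic function with `z ^ m` is a multiple of its Laurent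
coefficient. -/
theorem integral_mul_conj_zpow (hr : 0 < r) {f : ℂ → ℂ} (hf : DifferentiableOn ℂ f (shell r 1))
    (hf2 : MemLp f 2 (volume.restrict (shell r 1))) (m : ℤ) {σ : ℝ} (hσ : σ ∈ Ioo r 1) :
    ∫ z in shell r 1, f z * conj (z ^ m) =
      (2 * Real.pi * radialMoment r m : ℝ) * Real.circleAverage (fun z => f z * z ^ (-m)) 0 σ := by
  have hi : IntegrableOn (fun z => f z * conj (z ^ m)) (shell r 1) :=
    hf2.integrable_mul (memLp_zpow_shell hr m 2).star
  rw [integral_shell hr.le hi]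
  have key : ∀ ρ ∈ Ioo r 1, (2 * Real.pi * ρ) • Real.circleAverage (fun z => f z * conj (z ^ m)) 0 ρ =
      (2 * Real.pi * ρ ^ (2 * m + 1)) • Real.circleAverage (fun z => f z * z ^ (-m)) 0 σ := by
    intro ρ hρ
    have hρ0 : 0 < ρ := hr.trans hρ.1
    rw [← circleAverage_eq_of_differentiableOn_shell hr.le
      (hf.fun_mul (differentiableOn_zpow_shell hr (-m))) hρ hσ]
    have h1 : Real.circleAverage (fun z => f z * conj (z ^ m)) 0 ρ =
        Real.circleAverage (fun z => (ρ ^ (2 * m)) • (f z * z ^ (-m))) 0 ρ := by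
      apply Real.circleAverage_congr_sphere
      intro z hz
      have hz1 : ‖z‖ = ρ := by simpa [abs_of_pos hρ0] using hz
      have hz0 : z ≠ 0 := norm_pos_iff.1 (hz1 ▸ hρ0)
      have : conj z = (ρ : ℂ) ^ 2 * z⁻¹ := by
        rw [← hz1, ← Complex.mul_conj']
        field_simp
      simp only [map_zpow₀, this, Complex.real_smul]
      rw [mul_zpow, inv_zpow, zpow_neg, zpow_mul]
      push_cast
      norm_cast
      ring
    rw [h1, Real.circleAverage_fun_smul, smul_smul, zpow_add_one₀ hρ0.ne']
    congr 1
    ring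
  rw [setIntegral_congr_fun measurableSet_Ioo key, integral_smul_const, integral_const_mul,
    Complex.real_smul]
  rfl

theorem radialMoment_pos (hr : 0 < r) (hr1 : r < 1) (m : ℤ) : 0 < radialMoment r m := by
  rw [radialMoment, ← integral_Ioc_eq_integral_Ioo, ← intervalIntegral.integral_of_le hr1.le]
  refine intervalIntegral.intervalIntegral_pos_of_pos_on ?_ (fun x hx => ?_) hr1
  · apply ContinuousOn.intervalIntegrable
    intro x hx
    rw [uIcc_of_le hr1.le] at hx
    exact (continuousAt_zpow₀ x _ (Or.inl (hr.trans_le hx.1).ne')).continuousWithinAt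
  · exact zpow_pos (hr.trans hx.1) _

theorem circleAverage_zpow {ρ : ℝ} (hρ : 0 < ρ) (k : ℤ) :
    Real.circleAverage (fun z : ℂ => z ^ k) 0 ρ = if k = 0 then 1 else 0 := by
  split_ifs with hk
  · simp only [hk, zpow_zero]
    exact Real.circleAverage_const _ _ _
  · rw [Real.circleAverage_eq_circleIntegral hρ.ne']
    have h : (∮ z in C(0, ρ), (z - 0)⁻¹ • z ^ k) = ∮ z in C(0, ρ), (z - 0) ^ (k - 1) := by
      refine circleIntegral.integral_congr hρ.le fun z hz => ?_
      have hz0 : z ≠ 0 := Metric.ne_of_mem_sphere hz hρ.ne'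
      simp only [sub_zero, smul_eq_mul]
      rw [zpow_sub_one₀ hz0, mul_comm]
    rw [h, circleIntegral.integral_sub_zpow_of_ne (by omega), smul_zero]

/-- A holomorphic function all of whose Laurent coefficients vanish is zero: on each circle its
Fourier coefficients vanish. -/
theorem eq_zero_of_circleAverage_eq_zero {f : ℂ → ℂ} {ρ : ℝ} (hρ : 0 < ρ)
    (hf : ContinuousOn f (Metric.sphere 0 ρ))
    (h : ∀ m : ℤ, Real.circleAverage (fun z => f z * z ^ (-m)) 0 ρ = 0) {z : ℂ} (hz : ‖z‖ = ρ) :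
    f z = 0 := by
  have : Fact (0 < 2 * Real.pi) := ⟨by positivity⟩
  let F : C(AddCircle (2 * Real.pi), ℂ) := ⟨fun x => f (ρ * (AddCircle.toCircle x : ℂ)), by
    refine hf.comp_continuous (by fun_prop) fun x => ?_
    rw [mem_sphere_zero_iff_norm, norm_mul, Circle.norm_coe, mul_one, Complex.norm_real,
      Real.norm_of_nonneg hρ.le]⟩
  have hF : ∀ x : ℝ, F (x : AddCircle (2 * Real.pi)) = f (circleMap 0 ρ x) := by
    intro x
    change f _ = _
    rw [AddCircle.toCircle_apply_mk]
    congr 1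
    simp [circleMap]
  have hc : fourierCoeff F = 0 := by
    funext n
    rw [fourierCoeff_eq_intervalIntegral _ n 0, Pi.zero_apply]
    have h1 : ∀ x : ℝ, fourier (-n) (x : AddCircle (2 * Real.pi)) • F x =
        (ρ : ℂ) ^ n * (f (circleMap 0 ρ x) * (circleMap 0 ρ x) ^ (-n)) := by
      intro x
      have hρ' : (ρ : ℂ) ≠ 0 := by exact_mod_cast hρ.ne'
      rw [hF, fourier_coe_apply, smul_eq_mul, circleMap, zero_add, mul_zpow, ← Complex.exp_int_mul,
        zpow_neg]
      have : (2 * Real.pi * Complex.I * ((-n : ℤ) : ℂ) * x / (2 * Real.pi : ℝ) : ℂ) =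
          ((-n : ℤ) : ℂ) * (x * Complex.I) := by
        have : (Real.pi : ℂ) ≠ 0 := by exact_mod_cast Real.pi_ne_zero
        push_cast
        field_simp
      rw [this]
      have := zpow_ne_zero n hρ'
      field_simp
    simp_rw [h1]
    have h2 := h n
    rw [Real.circleAverage, smul_eq_zero] at h2
    rw [intervalIntegral.integral_const_mul, zero_add,
      h2.resolve_left (by positivity), mul_zero, smul_zero]
  have hs := has_pointwise_sum_fourier_series_of_summable (f := F) (by
    rw [hc]; exact summable_zero) (z.arg : AddCircle (2 * Real.pi))
  simp only [hc, Pi.zero_apply, zero_smul] at hs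
  have := hs.unique hasSum_zero
  rw [hF] at this
  rw [← this, circleMap, zero_add, ← hz, Complex.norm_mul_exp_arg_mul_I]

/-- The normalized monomials form an orthonormal basis of the Bergman space of the annulus. -/
theorem isPlanarOrthonormalBasis_zpow (hr : 0 < r) (hr1 : r < 1) :
    IsPlanarOrthonormalBasis (shell r 1) fun (m : ℤ) (z : ℂ) =>
      (((√(2 * Real.pi * radialMoment r m))⁻¹ : ℝ) : ℂ) * z ^ m := by
  obtain ⟨σ, hσ⟩ : ∃ σ, σ ∈ Ioo r 1 := exists_between hr1
  have hp : ∀ m, 0 < 2 * Real.pi * radialMoment r m := fun m =>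
    mul_pos (by positivity) (radialMoment_pos hr hr1 m)
  refine ⟨fun m => (differentiableOn_zpow_shell hr m).const_mul _,
    fun m => (memLp_zpow_shell hr m 2).const_mul _, fun m l => ?_, fun f hf hf2 h => ?_⟩
  · have h1 : ∀ z : ℂ, (((√(2 * Real.pi * radialMoment r m))⁻¹ : ℝ) : ℂ) * z ^ m *
        conj ((((√(2 * Real.pi * radialMoment r l))⁻¹ : ℝ) : ℂ) * z ^ l) =
        (((√(2 * Real.pi * radialMoment r m))⁻¹ * (√(2 * Real.pi * radialMoment r l))⁻¹ : ℝ) : ℂ) *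
          (z ^ m * conj (z ^ l)) := fun z => by
      rw [map_mul, Complex.conj_ofReal]
      push_cast
      ring
    simp_rw [h1]
    rw [integral_const_mul, integral_mul_conj_zpow hr (differentiableOn_zpow_shell hr m)
      (memLp_zpow_shell hr m 2) l hσ]
    have h2 : Real.circleAverage (fun z : ℂ => z ^ m * z ^ (-l)) 0 σ =
        Real.circleAverage (fun z : ℂ => z ^ (m - l)) 0 σ := by
      apply Real.circleAverage_congr_sphere
      intro z hz
      have hz0 : z ≠ 0 := Metric.ne_of_mem_sphere hz (by simpa using (hr.trans hσ.1).ne')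
      simp only
      rw [← zpow_add₀ hz0, sub_eq_add_neg]
    rw [h2, circleAverage_zpow (hr.trans hσ.1)]
    by_cases hml : m = l
    · subst hml
      simp only [sub_self, if_true, mul_one]
      norm_cast
      rw [← mul_inv, Real.mul_self_sqrt (hp m).le, inv_mul_cancel₀ (hp m).ne']
    · rw [if_neg hml, if_neg (sub_ne_zero.2 hml), mul_zero, mul_zero]
  · intro z hz
    refine eq_zero_of_circleAverage_eq_zero (hr.trans hz.1) (hf.continuousOn.mono fun w hw => ?_)
      (fun m => ?_) rfl
    · rw [mem_sphere_zero_iff_norm] at hw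
      exact ⟨hw ▸ hz.1, hw ▸ hz.2⟩
    · have h1 := h m
      simp_rw [map_mul, Complex.conj_ofReal, mul_left_comm (f _)] at h1
      rw [integral_const_mul, integral_mul_conj_zpow hr hf hf2 m ⟨hz.1, hz.2⟩, mul_eq_zero,
        mul_eq_zero] at h1
      have := (hp m).ne'
      have := (Real.sqrt_pos.2 (hp m)).ne'
      rcases h1 with h1 | h1 | h1
      · exact absurd h1 (by exact_mod_cast inv_ne_zero this)
      · exact absurd h1 (by exact_mod_cast (hp m).ne')
      · exact h1

/-! ### The kernel of the annulus in `Fin 1 → ℂ` -/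

theorem measurePreserving_const_annulus (r : ℝ) :
    MeasurePreserving (MeasurableEquiv.funUnique (Fin 1) ℂ).symm (volume.restrict (shell r 1))
      (volume.restrict (annulus r)) :=
  (volume_preserving_funUnique (Fin 1) ℂ).symm.restrict_preimage_emb
    (MeasurableEquiv.funUnique (Fin 1) ℂ).symm.measurableEmbedding (annulus r)

theorem integral_annulus (g : (Fin 1 → ℂ) → ℂ) :
    ∫ z in annulus r, g z = ∫ z in shell r 1, g fun _ => z :=
  ((measurePreserving_const_annulus r).integral_comp
    (MeasurableEquiv.funUnique (Fin 1) ℂ).symm.measurableEmbedding g).symm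

theorem memLp_annulus_iff {g : (Fin 1 → ℂ) → ℂ} {p : ℝ≥0∞} :
    MemLp g p (volume.restrict (annulus r)) ↔
      MemLp (fun z => g fun _ => z) p (volume.restrict (shell r 1)) := by
  rw [← (measurePreserving_const_annulus r).map_eq]
  exact (MeasurableEquiv.funUnique (Fin 1) ℂ).symm.measurableEmbedding.memLp_map_measure_iff

theorem differentiableOn_annulus_iff {g : (Fin 1 → ℂ) → ℂ} :
    DifferentiableOn ℂ g (annulus r) ↔
      DifferentiableOn ℂ (fun z => g fun _ => z) (shell r 1) := by
  constructor
  · intro h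
    exact h.comp (f := fun z : ℂ => fun _ : Fin 1 => z) (by fun_prop) fun z hz => hz
  · intro h
    have : g = (fun z => g fun _ => z) ∘ fun z : Fin 1 → ℂ => z 0 := by
      funext z
      exact congrArg g (funext fun i => by rw [Subsingleton.elim i 0])
    rw [this]
    exact h.comp (by fun_prop) fun z hz => hz

/-- Orthonormal bases on the annulus in `Fin 1 → ℂ` are those on the annulus in `ℂ`. -/
theorem isOrthonormalBasis_annulus_iff {φ : ℕ → (Fin 1 → ℂ) → ℂ} :
    IsOrthonormalBasis (annulus r) φ ↔
      IsPlanarOrthonormalBasis (shell r 1) fun i z => φ i fun _ => z := by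
  constructor
  · intro h
    refine ⟨fun i => differentiableOn_annulus_iff.1 (h.mem i).1,
      fun i => memLp_annulus_iff.1 (h.mem i).2, fun i j => ?_, fun f hf hf2 h0 z hz => ?_⟩
    · rw [← h.orthonormal, l2Inner, integral_annulus]
    · refine h.complete (fun z => f (z 0))
        ⟨differentiableOn_annulus_iff.2 hf, memLp_annulus_iff.2 hf2⟩ (fun i => ?_) (fun _ => z) hz
      rw [l2Inner, integral_annulus, h0]
  · intro h
    refine ⟨fun i => ⟨differentiableOn_annulus_iff.2 (h.differentiableOn i),
      memLp_annulus_iff.2 (h.memLp i)⟩, fun i j => ?_, fun f hf h0 z hz => ?_⟩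
    · rw [← h.orthonormal, l2Inner, integral_annulus]
    · have := h.complete (fun z => f fun _ => z) (differentiableOn_annulus_iff.1 hf.1)
        (memLp_annulus_iff.1 hf.2) (fun i => ?_) (z 0) hz
      · rwa [show (fun _ : Fin 1 => z 0) = z from funext fun i => by
          rw [Subsingleton.elim i 0]] at this
      · rw [← h0 i, l2Inner, integral_annulus]

theorem IsPlanarOrthonormalBasis.comp_equiv {U : Set ℂ} {ι κ : Type} [DecidableEq ι]
    [DecidableEq κ] {ψ : ι → ℂ → ℂ} (h : IsPlanarOrthonormalBasis U ψ) (e : κ ≃ ι) :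
    IsPlanarOrthonormalBasis U (ψ ∘ e) := by
  refine ⟨fun i => h.differentiableOn _, fun i => h.memLp _, fun i j => ?_,
    fun f hf hf2 h0 => h.complete f hf hf2 fun i => ?_⟩
  · simpa using h.orthonormal (e i) (e j)
  · simpa using h0 (e.symm i)

/-- The Bergman kernel of the annulus as a Laurent series. -/
theorem hasSum_kernel (hr : 0 < r) (hr1 : r < 1) {z w : Fin 1 → ℂ} (hz : z ∈ annulus r)
    (hw : w ∈ annulus r) :
    HasSum (fun m : ℤ => ((2 * Real.pi * radialMoment r m : ℝ) : ℂ)⁻¹ * (z 0 * conj (w 0)) ^ m)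
      (kernel (annulus r) z w) := by
  have hb := isPlanarOrthonormalBasis_zpow hr hr1
  have hex : ∃ φ : ℕ → (Fin 1 → ℂ) → ℂ, IsOrthonormalBasis (annulus r) φ :=
    ⟨fun i z => (((√(2 * Real.pi * radialMoment r (Equiv.intEquivNat.symm i)))⁻¹ : ℝ) : ℂ) *
      z 0 ^ Equiv.intEquivNat.symm i,
      isOrthonormalBasis_annulus_iff.2 (hb.comp_equiv Equiv.intEquivNat.symm)⟩
  obtain ⟨s, hs⟩ := exists_hasSum_mul_conj (isOpen_shell r 1) (z := z 0) (w := w 0) hz hw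
  have h1 := hs _ (isOrthonormalBasis_annulus_iff.1 hex.choose_spec)
  have h2 := hs _ hb
  have hc : ∀ v : Fin 1 → ℂ, (fun _ : Fin 1 => v 0) = v := fun v => funext fun i => by
    rw [Subsingleton.elim i 0]
  simp only [hc] at h1
  rw [kernel, dif_pos hex, h1.tsum_eq]
  convert h2 using 2 with m
  have hp : 0 ≤ 2 * Real.pi * radialMoment r m :=
    mul_nonneg (by positivity) (radialMoment_pos hr hr1 m).le
  rw [map_mul, Complex.conj_ofReal, map_zpow₀, mul_zpow, mul_mul_mul_comm, ← Complex.ofReal_mul,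
    ← mul_inv, Real.mul_self_sqrt hp, Complex.ofReal_inv]

/-! ### The Laurent series of the kernel -/

/-- The Laurent coefficients of `v ↦ r * v * K`, where `K` is the Bergman kernel of the annulus as
a function of `v = z * conj w / r`. The normalization makes them even in `m`. -/
def symmCoeff (r : ℝ) (m : ℤ) : ℝ := r ^ m * (2 * Real.pi * radialMoment r (m - 1))⁻¹

theorem radialMoment_sub_one (hr : 0 < r) (hr1 : r < 1) {m : ℤ} (hm : m ≠ 0) :
    radialMoment r (m - 1) = (1 - r ^ (2 * m)) / (2 * m) := by
  rw [radialMoment, ← integral_Ioc_eq_integral_Ioo, ← intervalIntegral.integral_of_le hr1.le,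
    integral_zpow]
  · rw [show 2 * (m - 1) + 1 + 1 = 2 * m by ring, one_zpow]
    push_cast
    congr 1
    ring
  · right
    refine ⟨by omega, fun h => ?_⟩
    rw [uIcc_of_le hr1.le] at h
    exact absurd h.1 (not_le.2 hr)

theorem symmCoeff_zero (hr : 0 < r) (hr1 : r < 1) :
    symmCoeff r 0 = (2 * Real.pi * Real.log r⁻¹)⁻¹ := by
  have : radialMoment r (0 - 1) = Real.log r⁻¹ := by
    rw [radialMoment, ← integral_Ioc_eq_integral_Ioo, ← intervalIntegral.integral_of_le hr1.le]
    norm_num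
    rw [integral_inv_of_pos hr one_pos]
    simp
  rw [symmCoeff, this, zpow_zero, one_mul]

theorem symmCoeff_pos (hr : 0 < r) (hr1 : r < 1) (m : ℤ) : 0 < symmCoeff r m :=
  mul_pos (zpow_pos hr m) (inv_pos.2 (mul_pos (by positivity) (radialMoment_pos hr hr1 _)))

theorem symmCoeff_neg (hr : 0 < r) (hr1 : r < 1) (m : ℤ) : symmCoeff r (-m) = symmCoeff r m := by
  rcases eq_or_ne m 0 with rfl | hm
  · rw [neg_zero]
  have key : ∀ k : ℤ, k ≠ 0 → symmCoeff r k = r ^ k * (Real.pi * (1 - (r ^ k) ^ 2) / k)⁻¹ ∧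
      1 - (r ^ k) ^ 2 ≠ 0 := by
    intro k hk
    have h := radialMoment_sub_one hr hr1 hk
    rw [mul_comm 2 k, zpow_mul, zpow_ofNat] at h
    refine ⟨?_, fun h0 => (radialMoment_pos hr hr1 (k - 1)).ne' (by rw [h, h0, zero_div])⟩
    have h2 : (k : ℝ) ≠ 0 := by exact_mod_cast hk
    rw [symmCoeff, h]
    field_simp
  have h1 : r ^ m ≠ 0 := zpow_ne_zero m hr.ne'
  have h2 : (m : ℝ) ≠ 0 := by exact_mod_cast hm
  obtain ⟨h3, h4⟩ := key m hm
  rw [h3, (key (-m) (neg_ne_zero.2 hm)).1, zpow_neg]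
  have h5 : 1 - ((r ^ m)⁻¹) ^ 2 = -(1 - (r ^ m) ^ 2) / (r ^ m) ^ 2 := by
    field_simp
    ring
  rw [h5]
  push_cast
  field_simp

theorem symmCoeff_natCast (hr : 0 < r) (hr1 : r < 1) {n : ℕ} (hn : n ≠ 0) :
    symmCoeff r n = n * r ^ n / (Real.pi * (1 - r ^ (2 * n))) := by
  rw [symmCoeff, radialMoment_sub_one hr hr1 (by exact_mod_cast hn)]
  have h1 : (n : ℝ) ≠ 0 := by exact_mod_cast hn
  have : 1 - r ^ (2 * n) ≠ 0 := (sub_pos.2 (pow_lt_one₀ hr.le hr1 (by omega))).ne'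
  norm_cast
  push_cast
  field_simp

theorem symmCoeff_natAbs (hr : 0 < r) (hr1 : r < 1) (m : ℤ) :
    symmCoeff r m = symmCoeff r m.natAbs := by
  rcases Int.natAbs_eq m with h | h
  · rw [← h]
  · conv_lhs => rw [h]
    exact symmCoeff_neg hr hr1 _

theorem symmCoeff_le (hr : 0 < r) (hr1 : r < 1) {m : ℤ} (hm : m ≠ 0) :
    symmCoeff r m ≤ (Real.pi * (1 - r ^ 2))⁻¹ * (m.natAbs * r ^ m.natAbs) := by
  rw [symmCoeff_natAbs hr hr1, symmCoeff_natCast hr hr1 (Int.natAbs_ne_zero.2 hm), div_eq_inv_mul]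
  have h1 : 0 < 1 - r ^ 2 := sub_pos.2 (pow_lt_one₀ hr.le hr1 two_ne_zero)
  gcongr ?_ * _
  apply inv_anti₀ (by positivity)
  gcongr Real.pi * (1 - ?_)
  have := Int.natAbs_pos.2 hm
  exact pow_le_pow_of_le_one hr.le hr1.le (by omega)

/-- The function `(t d/dt)^j (t K(t))`, where `K` is the Bergman kernel of the annulus as a function
of `t = z * conj w`. -/
def eulerSeries (r : ℝ) (j : ℕ) (t : ℂ) : ℂ :=
  ∑' m : ℤ, (m : ℂ) ^ j * symmCoeff r m * (t / r) ^ m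

theorem summable_natAbs_pow_mul {x : ℝ} (hx : 0 ≤ x) (hx1 : x < 1) (j : ℕ) :
    Summable fun m : ℤ => (m.natAbs : ℝ) ^ j * x ^ m.natAbs := by
  have h := summable_pow_mul_geometric_of_norm_lt_one j (r := x) (by
    rwa [Real.norm_of_nonneg hx])
  apply Summable.of_nat_of_neg
  · simpa using h
  · simpa using h

/-- A summable bound for the terms of `eulerSeries`, uniform on a shell. -/
theorem exists_summable_bound (hr : 0 < r) (hr1 : r < 1) {s : ℝ} (hs : r < s) (j : ℕ) :
    ∃ u : ℤ → ℝ, Summable u ∧ ∀ (m : ℤ) (v : ℂ), s < ‖v‖ → ‖v‖ < s⁻¹ →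
      ‖(m : ℂ) ^ j * symmCoeff r m * v ^ m‖ ≤ u m := by
  have hs0 : 0 < s := hr.trans hs
  have h1 : 0 < 1 - r ^ 2 := sub_pos.2 (pow_lt_one₀ hr.le hr1 two_ne_zero)
  refine ⟨fun m => (if m = 0 then symmCoeff r 0 else 0) + (Real.pi * (1 - r ^ 2))⁻¹ *
    ((m.natAbs : ℝ) ^ (j + 1) * (r / s) ^ m.natAbs), ?_, fun m v hv1 hv2 => ?_⟩
  · refine Summable.add (summable_of_ne_finset_zero (s := {0}) fun m hm => if_neg (by simpa using hm))
      ((summable_natAbs_pow_mul (by positivity) ((div_lt_one hs0).2 hs) _).mul_left _)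
  · have hm1 : ‖(m : ℂ)‖ = m.natAbs := by
      rw [Complex.norm_intCast, Nat.cast_natAbs, Int.cast_abs]
    rw [norm_mul, norm_mul, norm_pow, hm1, Complex.norm_real,
      Real.norm_of_nonneg (symmCoeff_pos hr hr1 m).le, norm_zpow]
    rcases eq_or_ne m 0 with rfl | hm
    · have : (((0 : ℤ).natAbs : ℝ)) ^ j ≤ 1 := pow_le_one₀ (by simp) (by simp)
      simp only [if_true, zpow_zero, mul_one, Int.natAbs_zero, pow_zero, Nat.cast_zero]
      have h2 := (symmCoeff_pos hr hr1 0).le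
      simp only [Int.natAbs_zero, Nat.cast_zero] at this
      rw [zero_pow (Nat.succ_ne_zero j), mul_zero, add_zero]
      exact mul_le_of_le_one_left h2 this
    · simp only [if_neg hm, zero_add]
      have hv : ‖v‖ ^ m ≤ s⁻¹ ^ m.natAbs := by
        rcases Int.natAbs_eq m with h | h
        · conv_lhs => rw [h, zpow_natCast]
          gcongr
        · conv_lhs => rw [h, zpow_neg, zpow_natCast, ← inv_pow]
          gcongr
      calc (m.natAbs : ℝ) ^ j * symmCoeff r m * ‖v‖ ^ m
          ≤ (m.natAbs : ℝ) ^ j * ((Real.pi * (1 - r ^ 2))⁻¹ * (m.natAbs * r ^ m.natAbs)) *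
              s⁻¹ ^ m.natAbs := by
            gcongr
            exact symmCoeff_le hr hr1 hm
        _ = _ := by
            rw [div_eq_mul_inv, mul_pow]
            ring

theorem exists_mem_shell {t : ℂ} (hr : 0 < r) (ht : t ∈ shell (r ^ 2) 1) :
    ∃ s, r < s ∧ s < ‖t / r‖ ∧ ‖t / r‖ < s⁻¹ := by
  have h1 : ‖t / r‖ = ‖t‖ / r := by
    rw [norm_div, Complex.norm_real, Real.norm_of_nonneg hr.le]
  rw [h1]
  have h2 : r < ‖t‖ / r := by rw [lt_div_iff₀ hr, ← sq]; exact ht.1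
  have h3 : r < (‖t‖ / r)⁻¹ := by
    rw [inv_div, lt_div_iff₀ (lt_trans (by positivity) ht.1)]
    exact mul_lt_of_lt_one_right hr ht.2
  obtain ⟨s, hs1, hs2⟩ := exists_between (lt_min h2 h3)
  refine ⟨s, hs1, hs2.trans_le (min_le_left _ _), ?_⟩
  rw [lt_inv_comm₀ (hr.trans h2) (hr.trans hs1)]
  exact hs2.trans_le (min_le_right _ _)

theorem summable_eulerSeries (hr : 0 < r) (hr1 : r < 1) (j : ℕ) {t : ℂ}
    (ht : t ∈ shell (r ^ 2) 1) :
    Summable fun m : ℤ => (m : ℂ) ^ j * symmCoeff r m * (t / r) ^ m := by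
  obtain ⟨s, hs, h1, h2⟩ := exists_mem_shell hr ht
  obtain ⟨u, hu, hb⟩ := exists_summable_bound hr hr1 hs j
  exact hu.of_norm_bounded fun m => hb m _ h1 h2

theorem hasDerivAt_eulerSeries (hr : 0 < r) (hr1 : r < 1) (j : ℕ) {t : ℂ}
    (ht : t ∈ shell (r ^ 2) 1) :
    HasDerivAt (eulerSeries r j) (eulerSeries r (j + 1) t / t) t := by
  have hr' : (r : ℂ) ≠ 0 := by exact_mod_cast hr.ne'
  obtain ⟨s, hs, h1, h2⟩ := exists_mem_shell hr ht
  obtain ⟨u, hu, hb⟩ := exists_summable_bound hr hr1 hs j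
  have hopen : IsOpen ((fun t : ℂ => t / r) ⁻¹' shell s s⁻¹) :=
    (isOpen_shell s s⁻¹).preimage (by fun_prop)
  have hmem : t ∈ (fun t : ℂ => t / r) ⁻¹' shell s s⁻¹ := ⟨h1, h2⟩
  have hd : ∀ (m : ℤ), ∀ x ∈ (fun t : ℂ => t / r) ⁻¹' shell s s⁻¹,
      HasDerivAt (fun t : ℂ => (m : ℂ) ^ j * symmCoeff r m * (t / r) ^ m)
        ((m : ℂ) ^ (j + 1) * symmCoeff r m * (x / r) ^ m / x) x := by
    intro m x hx
    have hx0 : x / r ≠ 0 := norm_pos_iff.1 ((hr.trans hs).trans hx.1)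
    have hx1 : x ≠ 0 := fun h => hx0 (by rw [h, zero_div])
    have h := ((hasDerivAt_zpow m (x / r) (Or.inl hx0)).comp x
      ((hasDerivAt_id x).div_const (r : ℂ))).const_mul ((m : ℂ) ^ j * symmCoeff r m)
    refine h.congr_deriv ?_
    rw [zpow_sub_one₀ hx0]
    field_simp
    ring
  have hdiff : ∀ m : ℤ, DifferentiableOn ℂ
      (fun t : ℂ => (m : ℂ) ^ j * symmCoeff r m * (t / r) ^ m)
      ((fun t : ℂ => t / r) ⁻¹' shell s s⁻¹) := fun m x hx =>
    (hd m x hx).differentiableAt.differentiableWithinAt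
  have hle : ∀ (m : ℤ) (x : ℂ), x ∈ (fun t : ℂ => t / r) ⁻¹' shell s s⁻¹ →
      ‖(m : ℂ) ^ j * symmCoeff r m * (x / r) ^ m‖ ≤ u m := fun m x hx => hb m _ hx.1 hx.2
  have hD := (Complex.differentiableOn_tsum_of_summable_norm hu hdiff hopen hle).differentiableAt
    (hopen.mem_nhds hmem)
  have hS := Complex.hasSum_deriv_of_summable_norm hu hdiff hopen hle hmem
  refine hD.hasDerivAt.congr_deriv ?_
  rw [← hS.tsum_eq, eulerSeries, ← tsum_div_const]
  exact tsum_congr fun m => (hd m t hmem).deriv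

/-- On the circle `|t| = r` the series are alternately real and imaginary. -/
theorem conj_eulerSeries (hr : 0 < r) (hr1 : r < 1) (j : ℕ) {t : ℂ} (ht : ‖t‖ = r) :
    conj (eulerSeries r j t) = (-1) ^ j * eulerSeries r j t := by
  have hr' : (r : ℂ) ≠ 0 := by exact_mod_cast hr.ne'
  have hc : conj (t / r) = (t / r)⁻¹ := by
    have ht0 : t ≠ 0 := norm_pos_iff.1 (ht ▸ hr)
    have : conj t * t = (r : ℂ) ^ 2 := by rw [Complex.conj_mul', ht]
    rw [map_div₀, Complex.conj_ofReal, inv_div, div_eq_div_iff hr' ht0, this, sq]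
  rw [eulerSeries, Complex.conj_tsum, ← (Equiv.neg ℤ).tsum_eq, ← tsum_mul_left]
  refine tsum_congr fun m => ?_
  simp only [Equiv.neg_apply, map_mul, map_pow, map_zpow₀, hc, Complex.conj_ofReal,
    symmCoeff_neg hr hr1, map_intCast]
  rw [inv_zpow, zpow_neg, inv_inv, Int.cast_neg, neg_pow]
  ring

/-- The Bergman kernel of the annulus in terms of `eulerSeries`. -/
theorem kernel_annulus (hr : 0 < r) (hr1 : r < 1) {z w : Fin 1 → ℂ} (hz : z ∈ annulus r)
    (hw : w ∈ annulus r) :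
    kernel (annulus r) z w = eulerSeries r 0 (z 0 * conj (w 0)) / (z 0 * conj (w 0)) := by
  have hz0 : z 0 ≠ 0 := norm_pos_iff.1 (hr.trans hz.1)
  have hw0 : w 0 ≠ 0 := norm_pos_iff.1 (hr.trans hw.1)
  have hr' : (r : ℂ) ≠ 0 := by exact_mod_cast hr.ne'
  set t := z 0 * conj (w 0) with ht
  have ht0 : t ≠ 0 := mul_ne_zero hz0 (by simpa using hw0)
  rw [← (hasSum_kernel hr hr1 hz hw).tsum_eq, ← (Equiv.subRight (1 : ℤ)).tsum_eq, eulerSeries,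
    ← tsum_div_const]
  refine tsum_congr fun m => ?_
  rw [Equiv.subRight_apply, ← ht, zpow_sub_one₀ ht0, symmCoeff, div_zpow]
  have := zpow_ne_zero m hr'
  push_cast
  field_simp

/-! ### Wirtinger derivatives of radial functions -/

/-- The real-linear form `X ↦ a X + b conj X`, that is `a dz + b dz̄`. -/
def wirtingerForm (a b : ℂ) : (Fin 1 → ℂ) →L[ℝ] ℂ :=
  a • (ContinuousLinearMap.proj 0 : (Fin 1 → ℂ) →L[ℝ] ℂ) +
    b • ((Complex.conjCLE : ℂ →L[ℝ] ℂ).comp (ContinuousLinearMap.proj 0))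

@[simp]
theorem wirtingerForm_apply (a b : ℂ) (X : Fin 1 → ℂ) :
    wirtingerForm a b X = a * X 0 + b * conj (X 0) := by
  simp [wirtingerForm]

theorem dz_eq {f : (Fin 1 → ℂ) → ℂ} {a b : ℂ} {z : Fin 1 → ℂ}
    (h : HasFDerivAt f (wirtingerForm a b) z) : dz 0 f z = a := by
  rw [dz, h.fderiv]
  simp only [wirtingerForm_apply, Pi.single_eq_same, map_one, Complex.conj_I]
  linear_combination (-(1 / 2) * a + (1 / 2) * b) * Complex.I_mul_I

theorem dzbar_eq {f : (Fin 1 → ℂ) → ℂ} {a b : ℂ} {z : Fin 1 → ℂ}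
    (h : HasFDerivAt f (wirtingerForm a b) z) : dzbar 0 f z = b := by
  rw [dzbar, h.fderiv]
  simp only [wirtingerForm_apply, Pi.single_eq_same, map_one, Complex.conj_I]
  linear_combination ((1 / 2) * a - (1 / 2) * b) * Complex.I_mul_I

theorem hasFDerivAt_coord (z : Fin 1 → ℂ) :
    HasFDerivAt (fun ζ : Fin 1 → ℂ => ζ 0) (wirtingerForm 1 0) z := by
  refine (ContinuousLinearMap.hasFDerivAt
    (ContinuousLinearMap.proj 0 : (Fin 1 → ℂ) →L[ℝ] ℂ)).congr_fderiv ?_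
  ext X
  simp

theorem hasFDerivAt_conj_coord (z : Fin 1 → ℂ) :
    HasFDerivAt (fun ζ : Fin 1 → ℂ => conj (ζ 0)) (wirtingerForm 0 1) z := by
  refine (ContinuousLinearMap.hasFDerivAt ((Complex.conjCLE : ℂ →L[ℝ] ℂ).comp
    (ContinuousLinearMap.proj 0 : (Fin 1 → ℂ) →L[ℝ] ℂ))).congr_fderiv ?_
  ext X
  simp

theorem hasFDerivAt_mul_wirtinger {f g : (Fin 1 → ℂ) → ℂ} {a b a' b' : ℂ} {z : Fin 1 → ℂ}
    (hf : HasFDerivAt f (wirtingerForm a b) z) (hg : HasFDerivAt g (wirtingerForm a' b') z) :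
    HasFDerivAt (fun ζ => f ζ * g ζ)
      (wirtingerForm (a * g z + f z * a') (b * g z + f z * b')) z := by
  refine (hf.mul hg).congr_fderiv ?_
  ext X
  simp
  ring

theorem hasFDerivAt_comp_wirtinger {f : (Fin 1 → ℂ) → ℂ} {a b : ℂ} {z : Fin 1 → ℂ}
    (hf : HasFDerivAt f (wirtingerForm a b) z) {Φ : ℂ → ℂ} {c : ℂ} (hΦ : HasDerivAt Φ c (f z)) :
    HasFDerivAt (fun ζ => Φ (f ζ)) (wirtingerForm (c * a) (c * b)) z := by
  refine (hΦ.complexToReal_fderiv.comp z hf).congr_fderiv ?_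
  ext X
  simp
  ring

theorem hasFDerivAt_normSq (z : Fin 1 → ℂ) :
    HasFDerivAt (fun ζ : Fin 1 → ℂ => ζ 0 * conj (ζ 0)) (wirtingerForm (conj (z 0)) (z 0)) z := by
  simpa using hasFDerivAt_mul_wirtinger (hasFDerivAt_coord z) (hasFDerivAt_conj_coord z)

/-- The complex Hessian of a radial function `Φ(|z|²)`: if `t Φ'(t) = χ(t)`, it is `χ'(|z|²)`. -/
theorem dz_dzbar_radial {f : (Fin 1 → ℂ) → ℂ} {z : Fin 1 → ℂ} (hz : z 0 ≠ 0) {Φ χ : ℂ → ℂ} {c : ℂ}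
    (hf : f =ᶠ[𝓝 z] fun ζ => Φ (ζ 0 * conj (ζ 0)))
    (hΦ : ∀ᶠ t in 𝓝 (z 0 * conj (z 0)), HasDerivAt Φ (χ t / t) t)
    (hχ : HasDerivAt χ c (z 0 * conj (z 0))) :
    dz 0 (dzbar 0 f) z = c := by
  have hcont : ContinuousAt (fun ζ : Fin 1 → ℂ => ζ 0 * conj (ζ 0)) z :=
    (hasFDerivAt_normSq z).continuousAt
  have h1 : dzbar 0 f =ᶠ[𝓝 z] fun ζ => χ (ζ 0 * conj (ζ 0)) * (conj (ζ 0))⁻¹ := by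
    have hne : ∀ᶠ ζ : Fin 1 → ℂ in 𝓝 z, ζ 0 ≠ 0 :=
      (continuous_apply 0).continuousAt.eventually_ne hz
    filter_upwards [hf.eventuallyEq_nhds, hcont.eventually hΦ, hne] with ζ h2 h3 h4
    have h5 := (hasFDerivAt_comp_wirtinger (hasFDerivAt_normSq ζ) h3).congr_of_eventuallyEq h2
    rw [dzbar_eq h5]
    field_simp
  have hz' : conj (z 0) ≠ 0 := by simpa using hz
  have h6 := hasFDerivAt_mul_wirtinger
    (hasFDerivAt_comp_wirtinger (hasFDerivAt_normSq z) hχ)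
    (hasFDerivAt_comp_wirtinger (hasFDerivAt_conj_coord z) (hasDerivAt_inv hz'))
  rw [dz_eq (h6.congr_of_eventuallyEq h1)]
  field_simp
  simp

/-! ### Metric, Ricci tensor and representative coordinates of the annulus -/

theorem isOpen_annulus (r : ℝ) : IsOpen (annulus r) :=
  (isOpen_shell r 1).preimage (f := fun z : Fin 1 → ℂ => z 0) (continuous_apply 0)

theorem mul_conj_mem_shell (hr : 0 < r) {z w : Fin 1 → ℂ} (hz : z ∈ annulus r)
    (hw : w ∈ annulus r) : z 0 * conj (w 0) ∈ shell (r ^ 2) 1 := by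
  constructor
  · rw [norm_mul, RCLike.norm_conj, sq]
    exact mul_lt_mul'' hz.1 hw.1 hr.le hr.le
  · rw [norm_mul, RCLike.norm_conj]
    exact mul_lt_one_of_nonneg_of_lt_one_left (norm_nonneg _) hz.2 hw.2.le

/-- The logarithmic derivative `t k'(t) / k(t)` of the Bergman kernel `k(z * conj w)` of the
annulus. -/
def kernelLogDeriv (r : ℝ) (t : ℂ) : ℂ := eulerSeries r 1 t / eulerSeries r 0 t - 1

/-- The discriminant `F₀ F₂ - F₁²` of the series; its zeros are the critical points of the
representative coordinate. -/
def eulerDiscr (r : ℝ) (t : ℂ) : ℂ :=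
  eulerSeries r 0 t * eulerSeries r 2 t - eulerSeries r 1 t ^ 2

theorem ne_zero_of_mem_shell_sq {t : ℂ} (ht : t ∈ shell (r ^ 2) 1) : t ≠ 0 :=
  norm_pos_iff.1 (lt_of_le_of_lt (sq_nonneg r) ht.1)

theorem hasDerivAt_kernelLogDeriv (hr : 0 < r) (hr1 : r < 1) {t : ℂ} (ht : t ∈ shell (r ^ 2) 1)
    (h0 : eulerSeries r 0 t ≠ 0) :
    HasDerivAt (kernelLogDeriv r) (eulerDiscr r t / (t * eulerSeries r 0 t ^ 2)) t := by
  have ht0 := ne_zero_of_mem_shell_sq ht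
  refine (((hasDerivAt_eulerSeries hr hr1 1 ht).div (hasDerivAt_eulerSeries hr hr1 0 ht)
    h0).sub_const 1).congr_deriv ?_
  rw [eulerDiscr]
  norm_num
  field_simp

theorem hasDerivAt_kernelFun (hr : 0 < r) (hr1 : r < 1) {t : ℂ} (ht : t ∈ shell (r ^ 2) 1)
    (h0 : eulerSeries r 0 t ≠ 0) :
    HasDerivAt (fun t => eulerSeries r 0 t / t)
      (kernelLogDeriv r t * (eulerSeries r 0 t / t) / t) t := by
  have ht0 := ne_zero_of_mem_shell_sq ht
  refine ((hasDerivAt_eulerSeries hr hr1 0 ht).div (hasDerivAt_id t) ht0).congr_deriv ?_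
  rw [kernelLogDeriv]
  simp
  field_simp

theorem continuousAt_eulerSeries (hr : 0 < r) (hr1 : r < 1) (j : ℕ) {t : ℂ}
    (ht : t ∈ shell (r ^ 2) 1) : ContinuousAt (eulerSeries r j) t :=
  (hasDerivAt_eulerSeries hr hr1 j ht).continuousAt

/-- On the positive axis, the series have positive real values for even `j`. -/
theorem eulerSeries_pos (hr : 0 < r) (hr1 : r < 1) {j : ℕ} (hj : Even j) {x : ℝ}
    (hx : (x : ℂ) ∈ shell (r ^ 2) 1) (hx0 : 0 < x) : ∃ y : ℝ, 0 < y ∧ eulerSeries r j x = y := by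
  have hs := summable_eulerSeries hr hr1 j hx
  have he : ∀ m : ℤ, (m : ℂ) ^ j * symmCoeff r m * ((x : ℂ) / r) ^ m =
      (((m : ℝ) ^ j * symmCoeff r m * (x / r) ^ m : ℝ) : ℂ) := fun m => by push_cast; rfl
  simp_rw [he] at hs
  rw [Complex.summable_ofReal] at hs
  refine ⟨∑' m : ℤ, (m : ℝ) ^ j * symmCoeff r m * (x / r) ^ m, ?_, ?_⟩
  · refine hs.tsum_pos (fun m => ?_) 1 ?_
    · exact mul_nonneg (mul_nonneg (hj.pow_nonneg _) (symmCoeff_pos hr hr1 m).le)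
        (zpow_nonneg (by positivity) m)
    · have := symmCoeff_pos hr hr1 1
      positivity
  · rw [eulerSeries, Complex.ofReal_tsum]
    exact tsum_congr he

theorem eulerSeries_odd (hr : 0 < r) (hr1 : r < 1) {j : ℕ} (hj : Odd j) :
    eulerSeries r j r = 0 := by
  have hr' : (r : ℂ) ≠ 0 := by exact_mod_cast hr.ne'
  rw [← CharZero.eq_neg_self_iff]
  conv_lhs => rw [eulerSeries, ← (Equiv.neg ℤ).tsum_eq]
  rw [eulerSeries, ← tsum_neg]
  refine tsum_congr fun m => ?_
  rw [Equiv.neg_apply, symmCoeff_neg hr hr1, div_self hr', one_zpow, one_zpow, Int.cast_neg,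
    hj.neg_pow]
  ring

theorem metricT_annulus (hr : 0 < r) (hr1 : r < 1) {z : Fin 1 → ℂ} (hz : z ∈ annulus r) :
    metricT (annulus r) z 0 0 = eulerDiscr r (z 0 * conj (z 0)) /
      (z 0 * conj (z 0) * eulerSeries r 0 (z 0 * conj (z 0)) ^ 2) := by
  have hz0 : z 0 ≠ 0 := norm_pos_iff.1 (hr.trans hz.1)
  have hmem := mul_conj_mem_shell hr hz hz
  have hsq : z 0 * conj (z 0) = ((‖z 0‖ ^ 2 : ℝ) : ℂ) := by rw [Complex.mul_conj']; push_cast; rfl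
  have hpos : (0 : ℝ) < ‖z 0‖ ^ 2 := by positivity
  obtain ⟨y, hy, hy'⟩ := eulerSeries_pos hr hr1 (j := 0) (by simp) (hsq ▸ hmem) hpos
  rw [← hsq] at hy'
  have h0 : eulerSeries r 0 (z 0 * conj (z 0)) ≠ 0 := by
    rw [hy']; exact_mod_cast hy.ne'
  have hev : ∀ᶠ t in 𝓝 (z 0 * conj (z 0)), t ∈ shell (r ^ 2) 1 :=
    (isOpen_shell _ _).mem_nhds hmem
  change dz 0 (dzbar 0 _) z = _
  refine dz_dzbar_radial (Φ := fun t => Complex.log (eulerSeries r 0 t / t))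
    (χ := kernelLogDeriv r) hz0 ?_ ?_ (hasDerivAt_kernelLogDeriv hr hr1 hmem h0)
  · filter_upwards [(isOpen_annulus r).mem_nhds hz] with ζ hζ
    rw [kernel_annulus hr hr1 hζ hζ]
  · have hslit : ∀ᶠ t in 𝓝 (z 0 * conj (z 0)), eulerSeries r 0 t / t ∈ Complex.slitPlane := by
      have hc : ContinuousAt (fun t => eulerSeries r 0 t / t) (z 0 * conj (z 0)) :=
        (continuousAt_eulerSeries hr hr1 0 hmem).div continuousAt_id
          (ne_zero_of_mem_shell_sq hmem)
      refine hc.eventually_mem (Complex.isOpen_slitPlane.mem_nhds ?_)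
      rw [hy', hsq, ← Complex.ofReal_div, Complex.ofReal_mem_slitPlane]
      positivity
    filter_upwards [hev, hslit,
      (continuousAt_eulerSeries hr hr1 0 hmem).eventually_ne h0] with t h1 h2 h3
    refine ((hasDerivAt_kernelFun hr hr1 h1 h3).clog h2).congr_deriv ?_
    have := ne_zero_of_mem_shell_sq h1
    field_simp

/-- At `t = r`, where the odd series vanish, the modified metric takes a simple form. -/
theorem modifiedMetric_annulus (hr : 0 < r) (hr1 : r < 1) {z : Fin 1 → ℂ} (hz : ‖z 0‖ ^ 2 = r) :
    modifiedMetric (annulus r) z 0 0 =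
      (eulerSeries r 4 r / eulerSeries r 2 r - eulerSeries r 2 r / eulerSeries r 0 r) / r := by
  have hr' : (r : ℂ) ≠ 0 := by exact_mod_cast hr.ne'
  have hz0 : z 0 ≠ 0 := fun h => by simp [h] at hz; exact hr.ne hz
  have hsq : z 0 * conj (z 0) = (r : ℂ) := by rw [Complex.mul_conj', ← hz]; push_cast; rfl
  have hmemA : z ∈ annulus r := by
    constructor
    · nlinarith [norm_nonneg (z 0)]
    · nlinarith [norm_nonneg (z 0)]
  have hmem : (r : ℂ) ∈ shell (r ^ 2) 1 := hsq ▸ mul_conj_mem_shell hr hmemA hmemA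
  have h1 := eulerSeries_odd hr hr1 (j := 1) (by decide)
  have h3 := eulerSeries_odd hr hr1 (j := 3) (by decide)
  obtain ⟨y0, hy0, hy0'⟩ := eulerSeries_pos hr hr1 (j := 0) (by decide) hmem hr
  obtain ⟨y2, hy2, hy2'⟩ := eulerSeries_pos hr hr1 (j := 2) (by decide) hmem hr
  have h0 : eulerSeries r 0 r ≠ 0 := by rw [hy0']; exact_mod_cast hy0.ne'
  have h2 : eulerSeries r 2 r ≠ 0 := by rw [hy2']; exact_mod_cast hy2.ne'
  have hD : eulerDiscr r r = eulerSeries r 0 r * eulerSeries r 2 r := by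
    rw [eulerDiscr, h1]; ring
  have hD0 : eulerDiscr r r ≠ 0 := hD ▸ mul_ne_zero h0 h2
  have hDder : ∀ t ∈ shell (r ^ 2) 1, HasDerivAt (eulerDiscr r)
      ((eulerSeries r 0 t * eulerSeries r 3 t - eulerSeries r 1 t * eulerSeries r 2 t) / t) t := by
    intro t ht
    have ht0 := ne_zero_of_mem_shell_sq ht
    refine (((hasDerivAt_eulerSeries hr hr1 0 ht).mul (hasDerivAt_eulerSeries hr hr1 2 ht)).sub
      ((hasDerivAt_eulerSeries hr hr1 1 ht).pow 2)).congr_deriv ?_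
    norm_num
    field_simp
    ring
  -- `χ` is the logarithmic derivative `t B' / B` of the metric coefficient `B = D / (t F₀²)`.
  let χ : ℂ → ℂ := fun t =>
    (eulerSeries r 0 t * eulerSeries r 3 t - eulerSeries r 1 t * eulerSeries r 2 t) /
      eulerDiscr r t - 1 - 2 * (eulerSeries r 1 t / eulerSeries r 0 t)
  have hχ : HasDerivAt χ ((eulerSeries r 4 r / eulerSeries r 2 r -
      3 * (eulerSeries r 2 r / eulerSeries r 0 r)) / r) r := by
    have e := fun j => hasDerivAt_eulerSeries hr hr1 j hmem
    refine (((((e 0).mul (e 3)).sub ((e 1).mul (e 2))).div (hDder r hmem) hD0).sub_const 1 |>.sub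
      (((e 1).div (e 0) h0).const_mul 2)).congr_deriv ?_
    simp only [Nat.reduceAdd, h1, h3, hD, Pi.mul_apply, Pi.sub_apply]
    field_simp
    ring
  have hric : ricci (annulus r) z 0 0 = -((eulerSeries r 4 r / eulerSeries r 2 r -
      3 * (eulerSeries r 2 r / eulerSeries r 0 r)) / r) := by
    change -dz 0 (dzbar 0 _) z = _
    rw [neg_inj]
    refine dz_dzbar_radial (Φ := fun t => Complex.log (eulerDiscr r t / (t * eulerSeries r 0 t ^ 2)))
      (χ := χ) hz0 ?_ ?_ (by rwa [hsq])
    · filter_upwards [(isOpen_annulus r).mem_nhds hmemA] with ζ hζ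
      rw [Matrix.det_fin_one, metricT_annulus hr hr1 hζ]
    · rw [hsq]
      have hslit : ∀ᶠ t in 𝓝 (r : ℂ),
          eulerDiscr r t / (t * eulerSeries r 0 t ^ 2) ∈ Complex.slitPlane := by
        have hc : ContinuousAt (fun t => eulerDiscr r t / (t * eulerSeries r 0 t ^ 2)) r :=
          (hDder r hmem).continuousAt.div
            (continuousAt_id.mul ((continuousAt_eulerSeries hr hr1 0 hmem).pow 2))
            (mul_ne_zero hr' (pow_ne_zero 2 h0))
        refine hc.eventually_mem (Complex.isOpen_slitPlane.mem_nhds ?_)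
        rw [hD, hy0', hy2']
        norm_cast
        rw [Complex.ofReal_mem_slitPlane]
        positivity
      filter_upwards [(isOpen_shell _ _).mem_nhds hmem, hslit,
        (continuousAt_eulerSeries hr hr1 0 hmem).eventually_ne h0,
        (hDder r hmem).continuousAt.eventually_ne hD0] with t ht hs ht0 htD
      have htne := ne_zero_of_mem_shell_sq ht
      refine (((hDder t ht).div ((hasDerivAt_id t).mul ((hasDerivAt_eulerSeries hr hr1 0 ht).pow 2))
        (mul_ne_zero htne (pow_ne_zero 2 ht0))).clog hs).congr_deriv ?_
      simp only [Nat.reduceAdd, Pi.mul_apply, Pi.div_apply, Pi.pow_apply, id, χ]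
      field_simp
      ring
  rw [modifiedMetric, Matrix.sub_apply, Matrix.smul_apply, hric, metricT_annulus hr hr1 hmemA,
    hsq, hD, smul_eq_mul]
  push_cast
  field_simp
  ring

theorem representativeMap_annulus (hr : 0 < r) (hr1 : r < 1) {p z : Fin 1 → ℂ}
    (hp : p ∈ annulus r) (hz : z ∈ annulus r) (h : kernel (annulus r) z p ≠ 0) :
    representativeMap (annulus r) p z = fun _ => (metricT (annulus r) p)⁻¹ 0 0 *
      ((kernelLogDeriv r (z 0 * conj (p 0)) - kernelLogDeriv r (p 0 * conj (p 0))) /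
        conj (p 0)) := by
  have hp0 : p 0 ≠ 0 := norm_pos_iff.1 (hr.trans hp.1)
  have hp0' : conj (p 0) ≠ 0 := by simpa using hp0
  have hz0 : z 0 ≠ 0 := norm_pos_iff.1 (hr.trans hz.1)
  have hzp := mul_conj_mem_shell hr hz hp
  have hpp := mul_conj_mem_shell hr hp hp
  have hsq : p 0 * conj (p 0) = ((‖p 0‖ ^ 2 : ℝ) : ℂ) := by rw [Complex.mul_conj']; push_cast; rfl
  obtain ⟨y, hy, hy'⟩ := eulerSeries_pos hr hr1 (j := 0) (by simp) (hsq ▸ hpp) (by positivity)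
  rw [← hsq] at hy'
  have h1 : eulerSeries r 0 (p 0 * conj (p 0)) ≠ 0 := by rw [hy']; exact_mod_cast hy.ne'
  have h2 : eulerSeries r 0 (z 0 * conj (p 0)) ≠ 0 := by
    rw [kernel_annulus hr hr1 hz hp] at h
    exact fun h' => h (by rw [h', zero_div])
  have hf1 : HasFDerivAt (fun ζ : Fin 1 → ℂ => z 0 * conj (ζ 0)) (wirtingerForm 0 (z 0)) p := by
    refine ((hasFDerivAt_conj_coord p).const_mul (z 0)).congr_fderiv ?_
    ext X
    simp
  have hA := hasFDerivAt_comp_wirtinger hf1 (hasDerivAt_kernelFun hr hr1 hzp h2)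
  have hB := hasFDerivAt_comp_wirtinger (hasFDerivAt_normSq p) (hasDerivAt_kernelFun hr hr1 hpp h1)
  have hB' := hasFDerivAt_comp_wirtinger hB
    (hasDerivAt_inv (div_ne_zero h1 (ne_zero_of_mem_shell_sq hpp)))
  have hC := hasFDerivAt_mul_wirtinger hA hB'
  have hev : (fun ζ => kernel (annulus r) z ζ / kernel (annulus r) ζ ζ) =ᶠ[𝓝 p] fun ζ =>
      eulerSeries r 0 (z 0 * conj (ζ 0)) / (z 0 * conj (ζ 0)) *
        (eulerSeries r 0 (ζ 0 * conj (ζ 0)) / (ζ 0 * conj (ζ 0)))⁻¹ := by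
    filter_upwards [(isOpen_annulus r).mem_nhds hp] with ζ hζ
    rw [kernel_annulus hr hr1 hz hζ, kernel_annulus hr hr1 hζ hζ, div_eq_mul_inv]
  funext i
  rw [Subsingleton.elim i 0]
  simp only [representativeMap, Finset.univ_unique, Fin.default_eq_zero, Finset.sum_singleton]
  rw [dzbar_eq (hC.congr_of_eventuallyEq hev), kernel_annulus hr hr1 hz hp,
    kernel_annulus hr hr1 hp hp]
  congr 1
  generalize eulerSeries r 0 (p 0 * conj (p 0)) = F at h1 ⊢
  generalize kernelLogDeriv r (p 0 * conj (p 0)) = c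
  field_simp
  ring

/-! ### The annulus as a domain -/

theorem isBoundedDomain_annulus (hr : 0 < r) (hr1 : r < 1) : IsBoundedDomain (annulus r) := by
  refine ⟨isOpen_annulus r, ?_, ?_⟩
  · have h : annulus r = (fun p : ℝ × ℝ => fun _ : Fin 1 => circleMap 0 p.1 p.2) ''
        (Ioo r 1 ×ˢ univ) := by
      ext z
      constructor
      · intro hz
        refine ⟨(‖z 0‖, (z 0).arg), ⟨hz, mem_univ _⟩, funext fun i => ?_⟩
        rw [Subsingleton.elim i 0]
        simp [circleMap]
      · rintro ⟨⟨ρ, θ⟩, ⟨hρ, -⟩, rfl⟩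
        have : ‖circleMap 0 ρ θ‖ = ρ := by rw [norm_circleMap_zero, abs_of_pos (hr.trans hρ.1)]
        exact ⟨this.symm ▸ hρ.1, this.symm ▸ hρ.2⟩
    rw [h]
    refine ((isConnected_Ioo hr1).prod isConnected_univ).image _ (Continuous.continuousOn ?_)
    unfold circleMap
    fun_prop
  · refine (Metric.isBounded_closedBall (x := (0 : Fin 1 → ℂ)) (r := 1)).subset fun z hz => ?_
    rw [mem_closedBall_zero_iff, pi_norm_le_iff_of_nonneg zero_le_one]
    intro i
    rw [Subsingleton.elim i 0]
    exact hz.2.le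

/-! ### Behaviour for small inner radius -/

/-- On the circle `|t| = r`, the terms of `eulerSeries` with `|m| ≥ 2` contribute `O(r²)`,
uniformly in the argument. -/
theorem exists_norm_eulerSeries_sub_le :
    ∃ C : ℝ, 0 < C ∧ ∀ r : ℝ, 0 < r → r ≤ 1 / 2 → ∀ j ≤ 4, ∀ θ : ℝ,
      ‖eulerSeries r j (circleMap 0 r θ) - ((0 : ℂ) ^ j * symmCoeff r 0 + symmCoeff r 1 *
        (Complex.exp (θ * Complex.I) + (-1) ^ j * (Complex.exp (θ * Complex.I))⁻¹))‖ ≤ C * r ^ 2 := by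
  have hsum := (summable_natAbs_pow_mul (x := 1 / 2) (by norm_num) (by norm_num) 5)
  refine ⟨4 * ∑' m : ℤ, (m.natAbs : ℝ) ^ 5 * (1 / 2) ^ m.natAbs,
    mul_pos (by norm_num) (hsum.tsum_pos (fun m => by positivity) 1 (by norm_num)),
    fun r hr hr2 j hj θ => ?_⟩
  have hr1 : r < 1 := by linarith
  have hr' : (r : ℂ) ≠ 0 := by exact_mod_cast hr.ne'
  set v := Complex.exp (θ * Complex.I) with hv
  have hv1 : ‖v‖ = 1 := Complex.norm_exp_ofReal_mul_I θ
  have ht : circleMap 0 r θ / r = v := by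
    rw [circleMap, zero_add, mul_div_cancel_left₀ _ hr']
  have hmem : circleMap 0 r θ ∈ shell (r ^ 2) 1 := by
    have : ‖circleMap 0 r θ‖ = r := by rw [norm_circleMap_zero, abs_of_pos hr]
    exact ⟨by rw [this]; nlinarith, by rw [this]; exact hr1⟩
  have hS := summable_eulerSeries hr hr1 j hmem
  rw [ht] at hS
  let s : Finset ℤ := {-1, 0, 1}
  let a : ℤ → ℂ := fun m => (m : ℂ) ^ j * symmCoeff r m * v ^ m
  have hfin : HasSum (fun m => if m ∈ s then a m else 0) (∑ m ∈ s, a m) := by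
    have : HasSum (fun m => if m ∈ s then a m else 0) (∑ m ∈ s, if m ∈ s then a m else 0) :=
      hasSum_sum_of_ne_finset_zero fun m hm => if_neg hm
    rwa [Finset.sum_congr rfl fun m hm => if_pos hm] at this
  have hmain : ∑ m ∈ s, a m = (0 : ℂ) ^ j * symmCoeff r 0 + symmCoeff r 1 *
      (v + (-1) ^ j * v⁻¹) := by
    have h1 := symmCoeff_neg hr hr1 1
    simp [s, a, h1]
    ring
  have hdiff := hS.hasSum.sub hfin
  rw [hmain] at hdiff
  have hE : eulerSeries r j (circleMap 0 r θ) = ∑' m : ℤ, a m := by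
    rw [eulerSeries, ht]
  rw [hE, ← hdiff.tsum_eq, mul_assoc, mul_comm _ (r ^ 2), ← mul_assoc]
  refine tsum_of_norm_bounded (hsum.hasSum.mul_left (4 * r ^ 2)) fun m => ?_
  split_ifs with hm
  · rw [sub_self, norm_zero]
    positivity
  · have hm' : 2 ≤ m.natAbs := by
      simp only [s, Finset.mem_insert, Finset.mem_singleton] at hm
      omega
    rw [sub_zero, norm_mul, norm_mul, norm_zpow, hv1, one_zpow, mul_one, norm_pow,
      Complex.norm_intCast, Complex.norm_real, Real.norm_of_nonneg (symmCoeff_pos hr hr1 m).le,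
      ← Int.cast_abs, ← Nat.cast_natAbs]
    have h1 := symmCoeff_le hr hr1 (m := m) (by omega)
    have h2 : (Real.pi * (1 - r ^ 2))⁻¹ ≤ 1 := by
      apply inv_le_one_of_one_le₀
      have : r ^ 2 ≤ 1 / 4 := by nlinarith
      nlinarith [Real.pi_gt_three]
    have h3 : r ^ m.natAbs ≤ 4 * r ^ 2 * (1 / 2) ^ m.natAbs := by
      obtain ⟨k, hk⟩ := Nat.exists_eq_add_of_le hm'
      rw [hk, pow_add, pow_add]
      have : r ^ k ≤ (1 / 2) ^ k := by gcongr
      nlinarith [sq_nonneg r]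
    have h4 : (m.natAbs : ℝ) ^ j ≤ (m.natAbs : ℝ) ^ 4 :=
      pow_le_pow_right₀ (by exact_mod_cast (by omega : 1 ≤ m.natAbs)) hj
    calc (m.natAbs : ℝ) ^ j * symmCoeff r m
        ≤ (m.natAbs : ℝ) ^ 4 * (1 * (m.natAbs * (4 * r ^ 2 * (1 / 2) ^ m.natAbs))) := by
          have h5 := (symmCoeff_pos hr hr1 m).le
          gcongr
          refine h1.trans ?_
          gcongr
      _ = _ := by ring

theorem symmCoeff_one_bounds (hr : 0 < r) (hr2 : r ≤ 1 / 2) :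
    r / Real.pi ≤ symmCoeff r 1 ∧ symmCoeff r 1 ≤ r := by
  have hr1 : r < 1 := by linarith
  have h := symmCoeff_natCast hr hr1 one_ne_zero
  simp only [Nat.cast_one, one_mul, pow_one, mul_one] at h
  have h1 : 0 < 1 - r ^ 2 := by nlinarith
  rw [h]
  constructor
  · gcongr
    nlinarith [Real.pi_pos, sq_nonneg r]
  · apply div_le_self hr.le
    nlinarith [Real.pi_gt_three]

theorem symmCoeff_zero_mul_log (hr : 0 < r) (hr1 : r < 1) :
    symmCoeff r 0 * Real.log r⁻¹ = 1 / (2 * Real.pi) := by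
  have := (Real.log_pos ((one_lt_inv₀ hr).2 hr1)).ne'
  rw [symmCoeff_zero hr hr1, mul_inv, mul_assoc, inv_mul_cancel₀ this, mul_one, one_div]

theorem eulerDiscr_re_eq (hr : 0 < r) (hr1 : r < 1) {t : ℂ} (ht : ‖t‖ = r) :
    eulerDiscr r t = (eulerDiscr r t).re := by
  rw [eq_comm, ← Complex.conj_eq_iff_re, eulerDiscr]
  simp only [map_sub, map_mul, map_pow, conj_eulerSeries hr hr1 _ ht]
  ring

/-- The real parts and norms of the series on `|t| = r`, up to `O(r²)`. -/
theorem exists_eulerSeries_bounds :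
    ∃ C : ℝ, 0 < C ∧ ∀ r : ℝ, 0 < r → r ≤ 1 / 2 → ∀ θ : ℝ,
      symmCoeff r 0 - 2 * r - C * r ^ 2 ≤ (eulerSeries r 0 (circleMap 0 r θ)).re ∧
      ‖eulerSeries r 1 (circleMap 0 r θ)‖ ≤ 2 * r + C * r ^ 2 ∧
      ∀ j, Even j → j ≠ 0 → j ≤ 4 →
        |(eulerSeries r j (circleMap 0 r θ)).re - 2 * symmCoeff r 1 * Real.cos θ| ≤ C * r ^ 2 := by
  obtain ⟨C, hC, hb⟩ := exists_norm_eulerSeries_sub_le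
  refine ⟨C, hC, fun r hr hr2 θ => ?_⟩
  have hr1 : r < 1 := by linarith
  have hb := hb r hr hr2
  obtain ⟨-, hβ2⟩ := symmCoeff_one_bounds hr hr2
  have hβ0 := symmCoeff_pos hr hr1 1
  set β := symmCoeff r 1
  refine ⟨?_, ?_, fun j hj hj0 hj4 => ?_⟩
  · have h := (Complex.abs_re_le_norm _).trans (hb 0 (by norm_num) θ)
    rw [← Complex.exp_neg] at h
    simp only [pow_zero, one_mul, Complex.sub_re, Complex.add_re, Complex.ofReal_re,
      Complex.re_ofReal_mul, Complex.exp_ofReal_mul_I_re, ← neg_mul, ← Complex.ofReal_neg,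
      Real.cos_neg] at h
    have := (abs_le.1 h).1
    nlinarith [Real.neg_one_le_cos θ]
  · have h := hb 1 (by norm_num) θ
    set v := Complex.exp (θ * Complex.I)
    have hv1 : ‖v‖ = 1 := Complex.norm_exp_ofReal_mul_I θ
    have h2 : ‖(0 : ℂ) ^ 1 * symmCoeff r 0 + β * (v + (-1) ^ 1 * v⁻¹)‖ ≤ 2 * r := by
      rw [pow_one, zero_mul, zero_add, norm_mul, Complex.norm_real, Real.norm_of_nonneg hβ0.le]
      have : ‖v + (-1) ^ 1 * v⁻¹‖ ≤ 2 := (norm_add_le _ _).trans (by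
        rw [norm_mul, norm_inv, hv1]; norm_num)
      nlinarith
    have := norm_sub_norm_le (eulerSeries r 1 (circleMap 0 r θ))
      ((0 : ℂ) ^ 1 * symmCoeff r 0 + β * (v + (-1) ^ 1 * v⁻¹))
    linarith
  · have h := (Complex.abs_re_le_norm _).trans (hb j hj4 θ)
    rw [← Complex.exp_neg, zero_pow hj0, hj.neg_one_pow] at h
    simp only [zero_mul, zero_add, one_mul, Complex.sub_re, Complex.add_re,
      Complex.re_ofReal_mul, Complex.exp_ofReal_mul_I_re, ← neg_mul, ← Complex.ofReal_neg,
      Real.cos_neg] at h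
    rwa [show 2 * β * Real.cos θ = β * (Real.cos θ + Real.cos θ) by ring]

/-- The smallness conditions on `r` under which the first-order terms dominate; they hold because
`r` and `r log (1 / r)` tend to `0`. -/
theorem eventually_dominated (C : ℝ) {c θ ℓ : ℝ} (hc : 0 < c) (hℓ : θ < ℓ) :
    ∀ᶠ r : ℝ in 𝓝[>] 0, 0 < r ∧ r < 1 / 2 ∧
      0 < 1 / (2 * Real.pi) - (2 + C * r) * (r * Real.log r⁻¹) ∧
      0 < 2 * c / Real.pi - C * r ∧
      r * Real.log r⁻¹ * (2 + C * r) ^ 2 <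
        (1 / (2 * Real.pi) - (2 + C * r) * (r * Real.log r⁻¹)) * (2 * c / Real.pi - C * r) ∧
      0 < 2 / Real.pi - C * r ∧
      θ * √((2 / Real.pi + C * r) / (2 / Real.pi - C * r)) < ℓ := by
  have hpi := Real.pi_pos
  have hid : Tendsto (fun r : ℝ => r) (𝓝[>] 0) (𝓝 0) :=
    tendsto_nhdsWithin_of_tendsto_nhds tendsto_id
  have hlog : Tendsto (fun r : ℝ => r * Real.log r⁻¹) (𝓝[>] 0) (𝓝 0) := by
    have := (tendsto_log_mul_rpow_nhdsGT_zero one_pos).neg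
    simp only [Real.rpow_one, neg_zero] at this
    refine this.congr fun x => ?_
    rw [Real.log_inv]
    ring
  have hA : Tendsto (fun r : ℝ => 1 / (2 * Real.pi) - (2 + C * r) * (r * Real.log r⁻¹)) (𝓝[>] 0)
      (𝓝 (1 / (2 * Real.pi))) := by
    simpa using tendsto_const_nhds.sub (((hid.const_mul C).const_add 2).mul hlog)
  have hB : Tendsto (fun r : ℝ => 2 * c / Real.pi - C * r) (𝓝[>] 0) (𝓝 (2 * c / Real.pi)) := by
    simpa using tendsto_const_nhds.sub (hid.const_mul C)
  have hE : Tendsto (fun r : ℝ => r * Real.log r⁻¹ * (2 + C * r) ^ 2) (𝓝[>] 0) (𝓝 0) := by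
    simpa using hlog.mul (((hid.const_mul C).const_add 2).pow 2)
  have hG : Tendsto (fun r : ℝ => 2 / Real.pi - C * r) (𝓝[>] 0) (𝓝 (2 / Real.pi)) := by
    simpa using tendsto_const_nhds.sub (hid.const_mul C)
  have hH : Tendsto (fun r : ℝ => 2 / Real.pi + C * r) (𝓝[>] 0) (𝓝 (2 / Real.pi)) := by
    simpa using tendsto_const_nhds.add (hid.const_mul C)
  have h0 : 2 / Real.pi ≠ 0 := by positivity
  have hL : Tendsto (fun r : ℝ => θ * √((2 / Real.pi + C * r) / (2 / Real.pi - C * r))) (𝓝[>] 0)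
      (𝓝 θ) := by
    have := ((hH.div hG h0).sqrt).const_mul θ
    rwa [div_self h0, Real.sqrt_one, mul_one] at this
  filter_upwards [self_mem_nhdsWithin, hid.eventually_lt_const (u := 1 / 2) (by norm_num),
    hA.eventually_const_lt (u := 0) (by positivity), hB.eventually_const_lt (u := 0) (by positivity),
    hE.eventually_lt (hA.mul hB) (by positivity), hG.eventually_const_lt (u := 0) (by positivity),
    hL.eventually_lt_const hℓ] with r h1 h2 h3 h4 h5 h6 h7
  exact ⟨h1, h2, h3, h4, h5, h6, h7⟩

/-- The discriminant is not positive at a point of `|t| = r` whose argument lies beyond `π / 2`: the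
leading term of `F₀ F₂` is negative, of order `r / log (1 / r)`, while `F₁²` is of order `r²`. Here
`-c` stands for the cosine of the argument. -/
theorem eulerDiscr_re_nonpos (hr : 0 < r) (hr1 : r < 1) {C c : ℝ} {t : ℂ} (ht : ‖t‖ = r)
    (h0 : symmCoeff r 0 - 2 * r - C * r ^ 2 ≤ (eulerSeries r 0 t).re)
    (h1 : ‖eulerSeries r 1 t‖ ≤ 2 * r + C * r ^ 2)
    (h2 : (eulerSeries r 2 t).re ≤ -(r * (2 * c / Real.pi - C * r)))
    (hB : 0 < 2 * c / Real.pi - C * r)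
    (hE : r * Real.log r⁻¹ * (2 + C * r) ^ 2 <
        (1 / (2 * Real.pi) - (2 + C * r) * (r * Real.log r⁻¹)) * (2 * c / Real.pi - C * r)) :
    (eulerDiscr r t).re ≤ 0 := by
  have hlog0 : 0 < Real.log r⁻¹ := Real.log_pos (one_lt_inv₀ hr |>.2 hr1)
  rw [← symmCoeff_zero_mul_log hr hr1] at hE
  set ℓ := Real.log r⁻¹
  have him : (eulerSeries r 0 t).im = 0 := by
    rw [← Complex.conj_eq_iff_im, conj_eulerSeries hr hr1 0 ht, pow_zero, one_mul]
  rw [eulerDiscr, Complex.sub_re, Complex.mul_re, him, zero_mul, sub_zero]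
  have h3 : -(eulerSeries r 1 t ^ 2).re ≤ (2 * r + C * r ^ 2) ^ 2 := by
    refine (neg_le_abs _).trans ((Complex.abs_re_le_norm _).trans ?_)
    rw [norm_pow]
    gcongr
  have h5 : (2 * r + C * r ^ 2) ^ 2 ≤ (symmCoeff r 0 - 2 * r - C * r ^ 2) *
      (r * (2 * c / Real.pi - C * r)) := by
    -- After multiplication by `log (1 / r)` and division by `r` this is `hE`.
    refine le_of_mul_le_mul_right ?_ hlog0
    have := mul_le_mul_of_nonneg_right hE.le hr.le
    linarith
  have h6 : 0 < r * (2 * c / Real.pi - C * r) := mul_pos hr hB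
  have h7 : 0 ≤ (eulerSeries r 0 t).re := by
    have := nonneg_of_mul_nonneg_left ((sq_nonneg _).trans h5) h6
    linarith
  have h8 := mul_le_mul_of_nonneg_right h0 h6.le
  have h9 := mul_le_mul_of_nonneg_left h2 h7
  linarith

/-- For small `r` the discriminant has a zero on `|t| = r` whose argument `θ` exceeds `π / 2` at most
slightly. The same holds for `θ √(F₄ / F₂ - F₂ / F₀)(r)`, which is the length in the modified metric
of an arc of angle `θ` of the circle `|z|² = r`. -/
theorem exists_eulerDiscr_eq_zero {ε : ℝ} (hε : 0 < ε) :
    ∃ r : ℝ, 0 < r ∧ r < 1 ∧ ∃ θ : ℝ, 0 ≤ θ ∧ eulerDiscr r (circleMap 0 r θ) = 0 ∧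
      eulerSeries r 0 (circleMap 0 r θ) ≠ 0 ∧
      θ * √(eulerSeries r 4 r / eulerSeries r 2 r - eulerSeries r 2 r / eulerSeries r 0 r).re <
        Real.pi / 2 + ε := by
  obtain ⟨C, hC, hb⟩ := exists_eulerSeries_bounds
  obtain ⟨δ, hδ0, hδ⟩ : ∃ δ, 0 < δ ∧ δ < min ε 1 := exists_between (lt_min hε one_pos)
  have hδε : δ < ε := hδ.trans_le (min_le_left _ _)
  have hδ1 : δ < 1 := hδ.trans_le (min_le_right _ _)
  have hc0 : 0 < Real.sin δ := Real.sin_pos_of_pos_of_lt_pi hδ0 (by linarith [Real.pi_gt_three])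
  have hcos : Real.cos (Real.pi / 2 + δ) = -Real.sin δ := by
    rw [add_comm, Real.cos_add_pi_div_two]
  obtain ⟨r, hr, hr2, hA, hB, hE, hG, hL⟩ :=
    (eventually_dominated C hc0 (add_lt_add_right hδε (Real.pi / 2))).exists
  set c := Real.sin δ
  set θ₁ := Real.pi / 2 + δ
  have hθ₁0 : 0 ≤ θ₁ := by positivity
  have hr1 : r < 1 := by linarith
  have hb := hb r hr hr2.le
  obtain ⟨hβ1, -⟩ := symmCoeff_one_bounds hr hr2.le
  have hlog0 : 0 < Real.log r⁻¹ := Real.log_pos (one_lt_inv₀ hr |>.2 hr1)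
  have hβ0 : 0 < symmCoeff r 0 - 2 * r - C * r ^ 2 := by
    refine (mul_pos_iff_of_pos_right hlog0).1 (hA.trans_eq ?_)
    rw [← symmCoeff_zero_mul_log hr hr1]
    ring
  have hnorm : ∀ θ, ‖circleMap 0 r θ‖ = r := fun θ => by
    rw [norm_circleMap_zero, abs_of_pos hr]
  have hmem : ∀ θ, circleMap 0 r θ ∈ shell (r ^ 2) 1 := fun θ =>
    ⟨by rw [hnorm]; nlinarith, by rw [hnorm]; exact hr1⟩
  have hreal : (r : ℂ) = circleMap 0 r 0 := by simp [circleMap]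
  have hrmem : (r : ℂ) ∈ shell (r ^ 2) 1 := hreal ▸ hmem 0
  obtain ⟨y0, hy0, hy0'⟩ := eulerSeries_pos hr hr1 (j := 0) (by decide) hrmem hr
  obtain ⟨y2, hy2, hy2'⟩ := eulerSeries_pos hr hr1 (j := 2) (by decide) hrmem hr
  obtain ⟨y4, hy4, hy4'⟩ := eulerSeries_pos hr hr1 (j := 4) (by decide) hrmem hr
  have hpos : 0 ≤ (eulerDiscr r (circleMap 0 r 0)).re := by
    rw [← hreal, eulerDiscr, eulerSeries_odd hr hr1 (j := 1) (by decide), hy0', hy2',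
      zero_pow two_ne_zero, sub_zero, ← Complex.ofReal_mul, Complex.ofReal_re]
    positivity
  have hneg : (eulerDiscr r (circleMap 0 r θ₁)).re ≤ 0 := by
    obtain ⟨h0, h1, h2⟩ := hb θ₁
    refine eulerDiscr_re_nonpos hr hr1 (hnorm θ₁) h0 h1 ?_ hB hE
    have h2 := (abs_le.1 (h2 2 (by decide) (by decide) (by decide))).2
    rw [hcos] at h2
    have h3 : r / Real.pi * (2 * c) ≤ symmCoeff r 1 * (2 * c) := by gcongr
    have h4 : r * (2 * c / Real.pi - C * r) = r / Real.pi * (2 * c) - C * r ^ 2 := by ring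
    linarith
  have hcont : ContinuousOn (fun θ => (eulerDiscr r (circleMap 0 r θ)).re) (Icc 0 θ₁) := by
    refine Complex.continuous_re.comp_continuousOn fun θ _ => ContinuousAt.continuousWithinAt ?_
    have e : ∀ j, ContinuousAt (fun θ => eulerSeries r j (circleMap 0 r θ)) θ := fun j =>
      ContinuousAt.comp (f := circleMap 0 r) (continuousAt_eulerSeries hr hr1 j (hmem θ))
        (continuous_circleMap 0 r).continuousAt
    exact ((e 0).mul (e 2)).sub ((e 1).pow 2)
  obtain ⟨θ, hθ, hzero⟩ := intermediate_value_Icc' hθ₁0 hcont ⟨hneg, hpos⟩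
  refine ⟨r, hr, hr1, θ, hθ.1, ?_, fun h => ?_, ?_⟩
  · rw [eulerDiscr_re_eq hr hr1 (hnorm θ)]
    exact_mod_cast hzero
  · have := (hb θ).1
    rw [h, Complex.zero_re] at this
    linarith
  · have h2 := (abs_le.1 ((hb 0).2.2 2 (by decide) (by decide) (by decide))).1
    have h4 := (abs_le.1 ((hb 0).2.2 4 (by decide) (by decide) (by decide))).2
    rw [← hreal, Real.cos_zero, mul_one, hy2', Complex.ofReal_re] at h2
    rw [← hreal, Real.cos_zero, mul_one, hy4', Complex.ofReal_re] at h4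
    rw [hy0', hy2', hy4', ← Complex.ofReal_div, ← Complex.ofReal_div, ← Complex.ofReal_sub,
      Complex.ofReal_re]
    refine lt_of_le_of_lt (mul_le_mul hθ.2 (Real.sqrt_le_sqrt ?_) (Real.sqrt_nonneg _) hθ₁0) hL
    refine (sub_le_self _ (div_pos hy2 hy0).le).trans ?_
    rw [div_le_div_iff₀ hy2 hG]
    have h5 : 2 / Real.pi * r ≤ 2 * symmCoeff r 1 := by
      have : 2 / Real.pi * r = 2 * (r / Real.pi) := by ring
      linarith
    have h7 : y4 - y2 ≤ 2 * C * r ^ 2 := by linarith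
    have h8 : (2 / Real.pi - C * r) * r ≤ y2 := by linarith
    have h9 := mul_le_mul_of_nonneg_right h7 hG.le
    have h10 := mul_le_mul_of_nonneg_left h8 (mul_pos hC hr).le
    linarith

/-! ### Critical points of the coordinate and the length of arcs -/

/-- The zeros of the discriminant are critical points of the representative coordinate. -/
theorem hasFDerivAt_representativeMap_zero (hr : 0 < r) (hr1 : r < 1) {p z : Fin 1 → ℂ}
    (hp : p ∈ annulus r) (hz : z ∈ annulus r) (h : kernel (annulus r) z p ≠ 0)
    (hD : eulerDiscr r (z 0 * conj (p 0)) = 0) :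
    HasFDerivAt (representativeMap (annulus r) p) (0 : (Fin 1 → ℂ) →L[ℂ] (Fin 1 → ℂ)) z := by
  have hmem := mul_conj_mem_shell hr hz hp
  have h0 : eulerSeries r 0 (z 0 * conj (p 0)) ≠ 0 := by
    rw [kernel_annulus hr hr1 hz hp] at h
    exact fun h' => h (by rw [h', zero_div])
  have hlin : HasFDerivAt (fun ζ : Fin 1 → ℂ => ζ 0 * conj (p 0))
      (conj (p 0) • (ContinuousLinearMap.proj 0 : (Fin 1 → ℂ) →L[ℂ] ℂ)) z :=
    (ContinuousLinearMap.hasFDerivAt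
      (ContinuousLinearMap.proj 0 : (Fin 1 → ℂ) →L[ℂ] ℂ)).mul_const (conj (p 0))
  have hk := hasDerivAt_kernelLogDeriv hr hr1 hmem h0
  rw [hD, zero_div] at hk
  have hev : representativeMap (annulus r) p =ᶠ[𝓝 z] fun ζ _ =>
      (metricT (annulus r) p)⁻¹ 0 0 *
      ((kernelLogDeriv r (ζ 0 * conj (p 0)) - kernelLogDeriv r (p 0 * conj (p 0))) /
        conj (p 0)) := by
    have hne : ∀ᶠ ζ in 𝓝 z, eulerSeries r 0 (ζ 0 * conj (p 0)) ≠ 0 :=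
      ((continuousAt_eulerSeries hr hr1 0 hmem).comp (f := fun ζ : Fin 1 → ℂ => ζ 0 * conj (p 0))
        hlin.continuousAt).eventually_ne h0
    filter_upwards [(isOpen_annulus r).mem_nhds hz, hne] with ζ hζ hζ0
    refine representativeMap_annulus hr hr1 hp hζ ?_
    rw [kernel_annulus hr hr1 hζ hp]
    exact div_ne_zero hζ0 (ne_zero_of_mem_shell_sq (mul_conj_mem_shell hr hζ hp))
  refine HasFDerivAt.congr_of_eventuallyEq (hasFDerivAt_pi'.2 fun i => ?_) hev
  have h1 := hk.comp_hasFDerivAt z hlin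
  have h2 := ((h1.sub_const (kernelLogDeriv r (p 0 * conj (p 0)))).mul_const
    (conj (p 0))⁻¹).const_mul ((metricT (annulus r) p)⁻¹ 0 0)
  refine h2.congr_fderiv ?_
  ext X
  simp

/-- The distance of two points of the circle `|z|² = r` is at most the length of an arc. -/
theorem modifiedDist_le (hr : 0 < r) (hr1 : r < 1) {θ : ℝ} (hθ : 0 ≤ θ) :
    modifiedDist (annulus r) (fun _ => circleMap 0 (√r) θ) (fun _ => circleMap 0 (√r) 0) ≤
      ENNReal.ofReal (θ * √(eulerSeries r 4 r / eulerSeries r 2 r -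
        eulerSeries r 2 r / eulerSeries r 0 r).re) := by
  have hr' : (r : ℂ) ≠ 0 := by exact_mod_cast hr.ne'
  have hs0 : 0 < √r := Real.sqrt_pos.2 hr
  have hsq : √r ^ 2 = r := Real.sq_sqrt hr.le
  have hnorm : ∀ s, ‖circleMap 0 (√r) s‖ = √r := fun s => by
    rw [norm_circleMap_zero, abs_of_pos hs0]
  let γ : ℝ → Fin 1 → ℂ := fun t _ => circleMap 0 (√r) (θ * (1 - t))
  have hγ : ContDiff ℝ 1 γ := by
    refine contDiff_pi.2 fun _ => (contDiff_circleMap 0 (√r)).comp ?_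
    fun_prop
  have hd : ∀ t, deriv γ t = fun _ => (-θ) • (circleMap 0 (√r) (θ * (1 - t)) * Complex.I) := by
    intro t
    refine (hasDerivAt_pi.2 fun _ => ?_).deriv
    refine HasDerivAt.scomp t (hasDerivAt_circleMap 0 (√r) _) ?_
    simpa using ((hasDerivAt_id t).const_sub 1).const_mul θ
  have hpc : IsPiecewiseC1 γ := by
    refine ⟨1, ![0, 1], Fin.strictMono_iff_lt_succ.2 fun i => ?_, rfl, rfl,
      fun k => hγ.contDiffOn⟩
    rw [Subsingleton.elim i 0]
    simp
  have hmem : ∀ t ∈ Icc (0 : ℝ) 1, γ t ∈ annulus r := by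
    intro t _
    change r < ‖circleMap 0 (√r) (θ * (1 - t))‖ ∧ ‖circleMap 0 (√r) (θ * (1 - t))‖ < 1
    rw [hnorm]
    exact ⟨by nlinarith, by nlinarith⟩
  refine (iInf₂_le γ ⟨hpc, hmem, by simp [γ], by simp [γ]⟩).trans_eq ?_
  have hM : ∀ t, modifiedNorm (annulus r) (γ t) (deriv γ t) =
      θ * √(eulerSeries r 4 r / eulerSeries r 2 r -
        eulerSeries r 2 r / eulerSeries r 0 r).re := by
    intro t
    rw [modifiedNorm]
    simp only [Finset.univ_unique, Fin.default_eq_zero, Finset.sum_singleton]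
    rw [modifiedMetric_annulus hr hr1 (by rw [hnorm, hsq]), hd, mul_assoc, Complex.mul_conj',
      norm_smul, norm_mul, hnorm, Complex.norm_I, mul_one, Real.norm_eq_abs, abs_neg,
      abs_of_nonneg hθ, div_mul_eq_mul_div, mul_div_assoc]
    have : ((θ * √r : ℝ) : ℂ) ^ 2 / r = ((θ ^ 2 : ℝ) : ℂ) := by
      rw [← Complex.ofReal_pow, mul_pow, hsq]
      push_cast
      field_simp
    rw [this, Complex.re_mul_ofReal, mul_comm, Real.sqrt_mul (sq_nonneg θ), Real.sqrt_sq hθ]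
  rw [modifiedLength]
  simp only [hM, lintegral_const, Measure.restrict_apply_univ, Real.volume_Icc]
  simp

end Bergman

end

theorem theorem5 :
    ∀ ε : ℝ, 0 < ε → ∃ r : ℝ, 0 < r ∧ r < 1 ∧ Bergman.IsBoundedDomain (Bergman.annulus r) ∧
      ∃ z₀ ∈ Bergman.annulus r,
        ∃ z ∈ Bergman.modifiedBall (Bergman.annulus r) z₀ (Real.pi / 2 + ε),
          Bergman.kernel (Bergman.annulus r) z z₀ ≠ 0 ∧
          DifferentiableAt ℂ (Bergman.representativeMap (Bergman.annulus r) z₀) z ∧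
          ¬ Function.Injective
            (fderiv ℂ (Bergman.representativeMap (Bergman.annulus r) z₀) z) := by
  intro ε hε
  obtain ⟨r, hr, hr1, θ, hθ, hD, h0, hlen⟩ := Bergman.exists_eulerDiscr_eq_zero hε
  have hs0 : 0 < √r := Real.sqrt_pos.2 hr
  have hsq : √r ^ 2 = r := Real.sq_sqrt hr.le
  have hmem : ∀ s, (fun _ => circleMap 0 (√r) s) ∈ Bergman.annulus r := fun s => by
    change r < ‖_‖ ∧ ‖_‖ < 1
    rw [norm_circleMap_zero, abs_of_pos hs0]
    exact ⟨by nlinarith, by nlinarith⟩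
  have hprod : circleMap 0 (√r) θ * (starRingEnd ℂ) (circleMap 0 (√r) 0) = circleMap 0 r θ := by
    simp only [circleMap, zero_add, Complex.ofReal_zero, zero_mul, Complex.exp_zero, mul_one,
      Complex.conj_ofReal]
    conv_rhs => rw [← hsq]
    push_cast
    ring
  have hK : Bergman.kernel (Bergman.annulus r) (fun _ => circleMap 0 (√r) θ)
      (fun _ => circleMap 0 (√r) 0) ≠ 0 := by
    rw [Bergman.kernel_annulus hr hr1 (hmem θ) (hmem 0), hprod]
    exact div_ne_zero h0 (by simpa [circleMap] using hr.ne')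
  have hd := Bergman.hasFDerivAt_representativeMap_zero hr hr1 (hmem 0) (hmem θ) hK
    (by rw [hprod, hD])
  refine ⟨r, hr, hr1, Bergman.isBoundedDomain_annulus hr hr1, _, hmem 0, _,
    ⟨hmem θ, (Bergman.modifiedDist_le hr hr1 hθ).trans_lt
      ((ENNReal.ofReal_lt_ofReal_iff (by positivity)).2 hlen)⟩, hK, hd.differentiableAt, ?_⟩
  rw [hd.fderiv]
  intro hinj
  have := congrFun (@hinj (fun _ => 0) (fun _ => 1) rfl) 0
  simp at this
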